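/- **Setting.** Let $d\ge 2$. A path $x:[0,1]\to\mathbb R^d$ has bounded variation if its total variation $\|x\|_{TV}=\sup\sum_i\|x_{t_i}-x_{t_{i-1}}\|$ (supremum over all finite subdivisions of $[0,1]$, Euclidean norm) is finite. Its signature coefficient along $I=(i_1,\dots,i_k)\in\{1,\dots,d\}^k$ is the iterated Stieltjes integral $$S^I(x)=\int\!\cdots\!\int_{0\le u_1<\dots<u_k\le 1}dx^{i_1}_{u_1}\cdots dx^{i_k}_{u_k},$$ with value $1$ for the empty index, and $S^m(x)\in\mathbb R^{s_d(m)}$, $s_d(m)=\sum_{k=0}^m d^k$, is the vector of all coefficients of order at most $m$. Let $X$ be a random path of bounded variation (the space of paths carries the $\sigma$-algebra generated by the evaluations) and $Y$ a real random variable. Assume that $\mathbb E[Y\mid X]=\langle\beta,S^m(X)\rangle$ a.s. for some $m\in\mathbb N$ and $\beta\in\mathbb R^{s_d(m)}$, let $m^*$ be the smallest such $m$, and let $\beta^*\in\mathbb R^{s_d(m^*)}$ satisfy $\mathbb E[Y\mid X]=\langle\beta^*,S^{m^*}(X)\rangle$ a.s. Assume $\mathrm{Var}(Y\mid X)\le\sigma^2$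 a.s., $\|\beta^*\|\le\alpha$ for some $\alpha>0$, and $|Y|\le K_Y$, $\|X\|_{TV}\le K_X$ a.s. for some $K_X,K_Y>0$. Put $K=2(K_Y+\alpha e^{K_X})e^{K_X}$, $B_{m,\alpha}=\{\beta\in\mathbb R^{s_d(m)}:\|\beta\|\le\alpha\}$ and $$L(m)=\inf_{\beta\in B_{m,\alpha}}\mathbb E\big(Y-\langle\beta,S^m(X)\rangle\big)^2,$$ with the convention $L(-1)=+\infty$, and assume $L(m^*-1)>\sigma^2$. **Estimator.** Let $(X_1,Y_1),\dots,(X_n,Y_n)$ be i.i.d. copies of $(X,Y)$ and $$\widehat L_n(m)=\min_{\beta\in B_{m,\alpha}}\frac1n\sum_{i=1}^n\big(Y_i-\langle\beta,S^m(X_i)\rangle\big)^2 .$$ Let $K_{\rm pen}>0$, $0<\rho<\tfrac12$, $\mathrm{pen}_n(m)=K_{\rm pen}\,n^{-\rho}\sqrt{s_d(m)}$, and let $\widehat m$ be the smallest minimiser over $m\in\mathbb N$ of $\widehat L_n(m)+\mathrm{pen}_n(m)$. **Theorem.** Let $n_0$ be the smallest integer such that $$n_0^{\min(\rho,\frac12-\rho)}\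 \ge\ \big(432K\alpha\sqrt\pi+K_{\rm pen}\big)\Big(\frac{2\sqrt{s_d(m^*+1)}}{L(m^*-1)-\sigma^2}+\frac{\sqrt{2s_d(m^*+1)}}{K_{\rm pen}\sqrt{d^{m^*+1}}}\Big).$$ Then, for every $n\ge n_0$, $$\mathbb P(\widehat m\ne m^*)\le C_1\exp\big(-C_2\,n^{1-2\rho}\big),$$ where $$C_1=74\sum_{m>0}e^{-C_3s_d(m)}+148\,m^*<\infty,\qquad C_3=\frac{K_{\rm pen}^2d^{m^*+1}}{128\,s_d(m^*+1)\,(72K^2\alpha^2+K_Y^2)},$$ $$C_2=\frac1{16(1152K^2\alpha^2+K_Y^2)}\min\Big(\frac{K_{\rm pen}^2d^{m^*+1}}{8\,s_d(m^*+1)},\ L(m^*-1)-\sigma^2\Big).$$ (For $m^*=0$ the convention means that the first fraction in the condition on $n_0$ is $0$ and that the minimum in $C_2$ is its first term.) -/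

import Mathlib

open MeasureTheory ProbabilityTheory

noncomputable section

namespace SignatureRegression

/-- Paths `[0,1] → ℝ^d` of bounded variation. They carry the sigma-algebra generated by the
evaluation maps (the subspace sigma-algebra of the product one). -/
abbrev BVPath (d : ℕ) : Type :=
  {x : unitInterval → EuclideanSpace ℝ (Fin d) // BoundedVariationOn x Set.univ}

/-- The total variation of a path, with respect to the Euclidean norm of `ℝ^d`. -/
def totalVariation {d : ℕ} (x : BVPath d) : ℝ :=
  (eVariationOn x.1 Set.univ).toReal

theorem coord_boundedVariationOn {d : ℕ} (x : BVPath d) (i : Fin d) :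
    BoundedVariationOn (fun t => x.1 t i) Set.univ :=
  (EuclideanSpace.proj i : EuclideanSpace ℝ (Fin d) →L[ℝ] ℝ).lipschitz.comp_boundedVariationOn x.2

/-- The signed Stieltjes measure `dX^i` on `[0,1]` of the `i`-th coordinate of a path; it gives
the mass `X^i_1 - X^i_0` to `[0,1]`. -/
def coordMeasure {d : ℕ} (x : BVPath d) (i : Fin d) : SignedMeasure unitInterval :=
  (coord_boundedVariationOn x i).vectorMeasure

/-- The iterated integral of `dX^{i_1} ⋯ dX^{i_k}` over `0 ≤ u_1 < ⋯ < u_k < t`, for the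
multi-index `I = (i_1, …, i_k)`. -/
def iteratedIntegral {d : ℕ} (x : BVPath d) : (k : ℕ) → (Fin k → Fin d) → unitInterval → ℝ
  | 0, _, _ => 1
  | k + 1, I, t =>
      ∫ᵛ u in Set.Iio t, iteratedIntegral x k (Fin.init I) u ∂•(coordMeasure x (I (Fin.last k)))

/-- The signature coefficient along the multi-index `I = (i_1, …, i_k)`: the iterated integral of
`dX^{i_1} ⋯ dX^{i_k}` over `0 ≤ u_1 < ⋯ < u_k ≤ 1`. It is `1` for the empty multi-index. -/
def sigCoeff {d : ℕ} (x : BVPath d) : (k : ℕ) → (Fin k → Fin d) → ℝ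
  | 0, _ => 1
  | k + 1, I =>
      ∫ᵛ u, iteratedIntegral x k (Fin.init I) u ∂•(coordMeasure x (I (Fin.last k)))

/-- Multi-indices of length at most `m` with entries in `{1, …, d}`. -/
abbrev MultiIndex (d m : ℕ) : Type := (k : Fin (m + 1)) × (Fin k → Fin d)

/-- `s_d(m) = 1 + d + ⋯ + d^m`, the number of signature coefficients of order at most `m`. -/
def sigDim (d m : ℕ) : ℕ := ∑ k ∈ Finset.range (m + 1), d ^ k

theorem card_multiIndex (d m : ℕ) : Fintype.card (MultiIndex d m) = sigDim d m := by
  simp [sigDim, Finset.sum_range]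

/-- The Euclidean space `ℝ^{s_d(m)}`, with coordinates indexed by the multi-indices. -/
abbrev SigSpace (d m : ℕ) : Type := EuclideanSpace ℝ (MultiIndex d m)

/-- The signature `S^m(X)` truncated at order `m`. -/
def truncSig {d : ℕ} (m : ℕ) (x : BVPath d) : SigSpace d m :=
  WithLp.toLp 2 fun I => sigCoeff x I.1 I.2

/-- The theoretical risk `R_m(β) = E (Y - ⟨β, S^m(X)⟩)²`. -/
def risk {d : ℕ} {Ω : Type*} [MeasurableSpace Ω] (μ : Measure Ω) (X : Ω → BVPath d) (Y : Ω → ℝ)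
    (m : ℕ) (β : SigSpace d m) : ℝ :=
  ∫ ω, (Y ω - inner ℝ β (truncSig m (X ω))) ^ 2 ∂μ

/-- The minimal theoretical risk `L(m)` over the ball of radius `α`. -/
def minRisk {d : ℕ} {Ω : Type*} [MeasurableSpace Ω] (μ : Measure Ω) (X : Ω → BVPath d)
    (Y : Ω → ℝ) (α : ℝ) (m : ℕ) : ℝ :=
  sInf (risk μ X Y m '' Metric.closedBall 0 α)

/-- The empirical risk of `β` on the data `(x_1, y_1), …, (x_n, y_n)`. -/
def empRisk {d n : ℕ} (x : Fin n → BVPath d) (y : Fin n → ℝ) (m : ℕ) (β : SigSpace d m) : ℝ :=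
  (1 / (n : ℝ)) * ∑ i, (y i - inner ℝ β (truncSig m (x i))) ^ 2

/-- The minimal empirical risk over the ball of radius `α`. -/
def minEmpRisk {d n : ℕ} (α : ℝ) (x : Fin n → BVPath d) (y : Fin n → ℝ) (m : ℕ) : ℝ :=
  sInf (empRisk x y m '' Metric.closedBall 0 α)

/-- The penalty `pen_n(m) = K_pen n^{-ρ} √(s_d(m))`. -/
def pen (d : ℕ) (Kpen ρ : ℝ) (n m : ℕ) : ℝ :=
  Kpen * (n : ℝ) ^ (-ρ) * √(sigDim d m : ℝ)

/-- The estimator of the truncation order: the smallest minimiser over `m ∈ ℕ` of the penalised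
minimal empirical risk. -/
def mHat {d n : ℕ} (α Kpen ρ : ℝ) (x : Fin n → BVPath d) (y : Fin n → ℝ) : ℕ :=
  sInf {m | ∀ k, minEmpRisk α x y m + pen d Kpen ρ n m ≤ minEmpRisk α x y k + pen d Kpen ρ n k}

/-- `K = 2 (K_Y + α e^{K_X}) e^{K_X}`. -/
def constK (α KX KY : ℝ) : ℝ := 2 * (KY + α * Real.exp KX) * Real.exp KX

/-- The lower bound required of `n_0 ^ min(ρ, 1/2 - ρ)`, where `gap` stands for
`L(m⋆ - 1) - σ²`. For `m⋆ = 0` the convention is `L(-1) = +∞`: the term with `gap` vanishes. -/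
def sampleThreshold (d : ℕ) (α K Kpen gap : ℝ) (mstar : ℕ) : ℝ :=
  (432 * K * α * √Real.pi + Kpen) *
    ((if mstar = 0 then 0 else 2 * √(sigDim d (mstar + 1) : ℝ) / gap) +
      √(2 * (sigDim d (mstar + 1) : ℝ)) / (Kpen * √((d : ℝ) ^ (mstar + 1))))

/-- The constant `C_3`. -/
def const3 (d : ℕ) (α K KY Kpen : ℝ) (mstar : ℕ) : ℝ :=
  Kpen ^ 2 * (d : ℝ) ^ (mstar + 1) /
    (128 * (sigDim d (mstar + 1) : ℝ) * (72 * K ^ 2 * α ^ 2 + KY ^ 2))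

/-- The constant `C_1 = 74 ∑_{m > 0} exp(-C_3 s_d(m)) + 148 m⋆`. -/
def const1 (d : ℕ) (α K KY Kpen : ℝ) (mstar : ℕ) : ℝ :=
  74 * ∑' m : ℕ, Real.exp (-const3 d α K KY Kpen mstar * (sigDim d (m + 1) : ℝ)) + 148 * mstar

/-- The constant `C_2`, where `gap` stands for `L(m⋆ - 1) - σ²`. For `m⋆ = 0` the convention is
`L(-1) = +∞`: the minimum is its first term. -/
def const2 (d : ℕ) (α K KY Kpen gap : ℝ) (mstar : ℕ) : ℝ :=
  1 / (16 * (1152 * K ^ 2 * α ^ 2 + KY ^ 2)) *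
    (if mstar = 0 then
      Kpen ^ 2 * (d : ℝ) ^ (mstar + 1) / (8 * (sigDim d (mstar + 1) : ℝ))
    else
      min (Kpen ^ 2 * (d : ℝ) ^ (mstar + 1) / (8 * (sigDim d (mstar + 1) : ℝ))) gap)

end SignatureRegression

end

open SignatureRegression

/-! If the estimated order is wrong, some order m ≠ m* has penalised empirical risk at most that of
m*. The two orders are compared in the larger coefficient space, after extension by zero. If m > m*,
the empirical risk of β* exceeds that of the empirical minimiser at order m by at least pen(m) -
pen(m*), although its true risk is no larger, because β* gives the conditional mean. If m < m*, the
true risk of the empirical minimiser at order m exceeds that of β* by at least L(m*-1) - σ², while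
its empirical excess is at most pen(m*), which is at most half this gap for n ≥ n₀. In both cases a
difference of two empirical risks is far from the difference of the true risks;
`measureReal_exists_deviation_le` bounds the probability of this, and a union bound over m
concludes.

The deviation bound needs no chaining. The difference (y - ⟨β, s⟩)² - (y - ⟨β', s⟩)² is the inner
product of a vector depending only on β, β' with the tensor s ⊗ (y/α, s) (`inner_lossDirection`). By
Cauchy-Schwarz, the supremum over the ball is at most 5α² times the norm of a centred empirical
mean, which the dimension-free Hoeffding inequality `measureReal_norm_sum_ge_le` controls. Each m
thus costs a factor 2, well within the constants 74 and 148.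

The tensor is bounded since ‖S^m(x)‖ ≤ exp ‖x‖_TV (`norm_truncSig_le`), by factorial decay of the
levels of the signature. Paths may jump; Riemann sums at left endpoints give both this decay and the
measurability of the signature. -/

/-! ### Hoeffding's inequality in a Hilbert space -/

section Concentration

/-- As a function of r², cosh r is a power series with nonnegative coefficients, hence convex and
increasing. -/
theorem Real.cosh_le_of_sq_le {r a b w : ℝ} (hw₀ : 0 ≤ w) (hw₁ : w ≤ 1)
    (hr : r ^ 2 ≤ w * a ^ 2 + (1 - w) * b ^ 2) :
    Real.cosh r ≤ w * Real.cosh a + (1 - w) * Real.cosh b := by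
  refine hasSum_le (fun n => ?_) (Real.hasSum_cosh r)
    (((Real.hasSum_cosh a).mul_left w).add ((Real.hasSum_cosh b).mul_left (1 - w)))
  have h := (convexOn_pow (𝕜 := ℝ) n).2 (Set.mem_Ici.2 (sq_nonneg a))
    (Set.mem_Ici.2 (sq_nonneg b)) hw₀ (sub_nonneg.2 hw₁) (by ring)
  simp only [smul_eq_mul] at h
  have h' := (pow_le_pow_left₀ (sq_nonneg r) hr n).trans h
  have hf : (0 : ℝ) < ((2 * n).factorial : ℝ) := by positivity
  simp only [pow_mul]
  rw [← mul_div_assoc, ← mul_div_assoc, ← add_div]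
  gcongr

variable {E : Type*} [NormedAddCommGroup E] [InnerProductSpace ℝ E]

theorem cosh_norm_add_le (s z : E) {B : ℝ} (hB : 0 < B) (hz : ‖z‖ ≤ B) :
    Real.cosh ‖s + z‖ ≤ Real.cosh ‖s‖ * Real.cosh B +
      inner ℝ ((Real.sinh ‖s‖ / ‖s‖ * (Real.sinh B / B)) • s) z := by
  rcases eq_or_ne s 0 with rfl | hs
  · simpa using (Real.cosh_le_cosh (x := ‖z‖) (y := B)).2 (by rwa [abs_norm, abs_of_pos hB])
  have hs' : 0 < ‖s‖ := norm_pos_iff.2 hs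
  have hsB : 0 < ‖s‖ * B := mul_pos hs' hB
  set θ : ℝ := inner ℝ s z / (‖s‖ * B) with hθ
  have hin : inner ℝ s z = θ * (‖s‖ * B) := by rw [hθ, div_mul_cancel₀ _ hsB.ne']
  have habs : |inner ℝ s z| ≤ ‖s‖ * B := (abs_real_inner_le_norm s z).trans (by gcongr)
  have hθ1 : |θ| ≤ 1 := by
    rw [hθ, abs_div, abs_of_pos hsB]; exact div_le_one_of_le₀ habs hsB.le
  obtain ⟨hl, hu⟩ := abs_le.1 hθ1
  -- With this weight, w (‖s‖ + B)² + (1 - w) (‖s‖ - B)² = ‖s‖² + 2⟨s, z⟩ + B², which dominates ‖s +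
  -- z‖².
  have key := Real.cosh_le_of_sq_le (r := ‖s + z‖) (a := ‖s‖ + B) (b := ‖s‖ - B)
    (w := (1 + θ) / 2) (by linarith) (by linarith) (by
      rw [norm_add_sq_real, hin]
      have : ‖z‖ ^ 2 ≤ B ^ 2 := by gcongr
      linarith)
  rw [inner_smul_left, hin]
  rw [Real.cosh_add, Real.cosh_sub] at key
  refine key.trans (le_of_eq ?_)
  simp only [conj_trivial]
  field_simp
  ring

variable [CompleteSpace E] [MeasurableSpace E] [BorelSpace E] [SecondCountableTopology E]
  {Ω ι : Type*} [MeasurableSpace Ω] {P : Measure Ω} [IsProbabilityMeasure P]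

/-- Induction on the sum: in `cosh_norm_add_le` the term linear in the new variable has a
coefficient depending only on the earlier ones, so independence and centring give it mean zero. Each
summand costs a factor cosh B. -/
theorem integral_cosh_norm_sum_le {Z : ι → Ω → E} (hZ : ∀ i, AEMeasurable (Z i) P)
    (hindep : iIndepFun Z P) {B : ℝ} (hB : 0 < B) (hb : ∀ i, ∀ᵐ ω ∂P, ‖Z i ω‖ ≤ B)
    (hmean : ∀ i, ∫ ω, Z i ω ∂P = 0) (s : Finset ι) :
    Integrable (fun ω => Real.cosh ‖∑ i ∈ s, Z i ω‖) P ∧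
      ∫ ω, Real.cosh ‖∑ i ∈ s, Z i ω‖ ∂P ≤ Real.cosh B ^ s.card := by
  classical
  have hint : ∀ i, Integrable (Z i) P := fun i =>
    Integrable.of_bound (hZ i).aestronglyMeasurable B (hb i)
  have hbd : ∀ s : Finset ι, ∀ᵐ ω ∂P, ‖∑ i ∈ s, Z i ω‖ ≤ s.card * B := fun s => by
    have : ∀ᵐ ω ∂P, ∀ i ∈ s, ‖Z i ω‖ ≤ B := (ae_ball_iff s.countable_toSet).2 fun i _ => hb i
    filter_upwards [this] with ω hω
    simpa using norm_sum_le_of_le s hω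
  have hms : ∀ s : Finset ι, AEMeasurable (fun ω => ∑ i ∈ s, Z i ω) P := fun s =>
    Finset.aemeasurable_fun_sum s fun i _ => hZ i
  have hcosh : ∀ s : Finset ι, Integrable (fun ω => Real.cosh ‖∑ i ∈ s, Z i ω‖) P := fun s => by
    refine Integrable.of_bound
      (Real.continuous_cosh.measurable.comp_aemeasurable (hms s).norm).aestronglyMeasurable
      (Real.cosh (s.card * B)) ?_
    filter_upwards [hbd s] with ω hω
    rw [Real.norm_eq_abs, abs_of_pos (Real.cosh_pos _)]
    exact Real.cosh_le_cosh.2 (by rwa [abs_norm, abs_of_nonneg (by positivity)])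
  refine ⟨hcosh s, ?_⟩
  induction s using Finset.induction_on with
  | empty => simp
  | insert a s ha ih =>
    set S : Ω → E := fun ω => ∑ i ∈ s, Z i ω with hS
    have hSZ : IndepFun S (Z a) P := by
      have := hindep.indepFun_finsetSum_of_notMem₀ hZ ha
      convert this using 1
      ext ω; simp [hS]
    let g : E → E := fun x => (Real.sinh ‖x‖ / ‖x‖ * (Real.sinh B / B)) • x
    have hg : Measurable g := by
      refine Measurable.smul (Measurable.mul_const (Measurable.div ?_ measurable_norm) _) measurable_id
      exact Real.continuous_sinh.measurable.comp measurable_norm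
    have hgS : Integrable (fun ω => g (S ω)) P := by
      refine Integrable.of_bound (hg.comp_aemeasurable (hms s)).aestronglyMeasurable
        (Real.sinh (s.card * B) * (Real.sinh B / B)) ?_
      filter_upwards [hbd s] with ω hω
      have h1 : 0 ≤ Real.sinh B / B := div_nonneg (Real.sinh_nonneg_iff.2 hB.le) hB.le
      have h2 : 0 ≤ Real.sinh ‖S ω‖ := Real.sinh_nonneg_iff.2 (norm_nonneg _)
      have h3 : Real.sinh ‖S ω‖ ≤ Real.sinh (s.card * B) := Real.sinh_le_sinh.2 hω
      simp only [g, norm_smul, norm_mul, norm_div, Real.norm_eq_abs, abs_norm]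
      rw [abs_of_nonneg h2, ← abs_of_nonneg h1, abs_div]
      rcases eq_or_ne (S ω) 0 with h0 | h0
      · rw [h0]; simp only [norm_zero, mul_zero]
        exact mul_nonneg (h2.trans h3) (by positivity)
      · have : ‖S ω‖ ≠ 0 := norm_ne_zero_iff.2 h0
        rw [mul_right_comm, div_mul_cancel₀ _ this]
        gcongr
    have hgZ : IndepFun (fun ω => g (S ω)) (Z a) P := hSZ.comp hg measurable_id
    have hmul : Integrable (fun ω => inner ℝ (g (S ω)) (Z a ω)) P :=
      hgZ.integrable_bilin hgS (hint a) (innerSL ℝ)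
    have hzero : ∫ ω, inner ℝ (g (S ω)) (Z a ω) ∂P = 0 := by
      have := hgZ.integral_bilin hgS (hint a) (innerSL ℝ)
      exact this.trans (by rw [hmean a, map_zero])
    calc ∫ ω, Real.cosh ‖∑ i ∈ insert a s, Z i ω‖ ∂P
        ≤ ∫ ω, (Real.cosh ‖S ω‖ * Real.cosh B + inner ℝ (g (S ω)) (Z a ω)) ∂P := by
          refine integral_mono_ae (hcosh _) (((hcosh s).mul_const _).add hmul) ?_
          filter_upwards [hb a] with ω hω
          simp only [Finset.sum_insert ha]
          rw [add_comm]
          exact cosh_norm_add_le _ _ hB hω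
      _ = (∫ ω, Real.cosh ‖S ω‖ ∂P) * Real.cosh B := by
          rw [integral_add ((hcosh s).mul_const _) hmul, hzero, add_zero, integral_mul_const]
      _ ≤ Real.cosh B ^ (insert a s).card := by
          rw [Finset.card_insert_of_notMem ha, pow_succ]
          exact mul_le_mul_of_nonneg_right ih (Real.cosh_pos _).le

/-- **Hoeffding's inequality in Hilbert spaces**, dimension free. -/
theorem measureReal_norm_sum_ge_le [Fintype ι] {Z : ι → Ω → E} (hZ : ∀ i, AEMeasurable (Z i) P)
    (hindep : iIndepFun Z P) {B : ℝ} (hB : 0 < B) (hb : ∀ i, ∀ᵐ ω ∂P, ‖Z i ω‖ ≤ B)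
    (hmean : ∀ i, ∫ ω, Z i ω ∂P = 0) (hι : 0 < Fintype.card ι) {t : ℝ} (ht : 0 < t) :
    P.real {ω | t ≤ ‖∑ i, Z i ω‖} ≤ 2 * Real.exp (-t ^ 2 / (2 * Fintype.card ι * B ^ 2)) := by
  set n : ℝ := ((Fintype.card ι : ℕ) : ℝ) with hn
  have hn0 : 0 < n := Nat.cast_pos.2 hι
  -- The minimiser of n (lB)² / 2 - lt, the exponent of the Chernoff bound.
  set l : ℝ := t / (n * B ^ 2) with hl
  have hl0 : 0 < l := by positivity
  obtain ⟨hint, hle⟩ := integral_cosh_norm_sum_le (P := P) (Z := fun i ω => l • Z i ω)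
    (fun i => (hZ i).const_smul l)
    (hindep.comp (fun _ x => l • x) (fun _ => measurable_const_smul l)) (mul_pos hl0 hB)
    (fun i => by
      filter_upwards [hb i] with ω hω
      rw [norm_smul, Real.norm_of_nonneg hl0.le]; gcongr)
    (fun i => by rw [integral_smul, hmean i, smul_zero]) Finset.univ
  have hmark := mul_meas_ge_le_integral_of_nonneg (μ := P)
    (Filter.Eventually.of_forall fun ω => (Real.cosh_pos _).le) hint (Real.cosh (l * t))
  have hsub : P.real {ω | t ≤ ‖∑ i, Z i ω‖} ≤
      P.real {ω | Real.cosh (l * t) ≤ Real.cosh ‖∑ i, l • Z i ω‖} := by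
    refine measureReal_mono (fun ω (hω : t ≤ _) => ?_)
    refine Real.cosh_le_cosh.2 ?_
    rw [← Finset.smul_sum, norm_smul, Real.norm_of_nonneg hl0.le, abs_of_pos (by positivity),
      abs_of_nonneg (by positivity)]
    gcongr
  have h1 : Real.exp (l * t) / 2 ≤ Real.cosh (l * t) := by
    rw [Real.cosh_eq]; linarith [Real.exp_pos (-(l * t))]
  have h2 : Real.cosh (l * B) ^ Fintype.card ι ≤ Real.exp (n * ((l * B) ^ 2 / 2)) := by
    rw [hn, Real.exp_nat_mul]
    exact pow_le_pow_left₀ (Real.cosh_pos _).le (Real.cosh_le_exp_half_sq _) _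
  have h3 : Real.exp (l * t) / 2 * P.real {ω | t ≤ ‖∑ i, Z i ω‖} ≤
      Real.exp (n * ((l * B) ^ 2 / 2)) :=
    calc _ ≤ Real.cosh (l * t) * P.real {ω | Real.cosh (l * t) ≤ Real.cosh ‖∑ i, l • Z i ω‖} := by
          gcongr
      _ ≤ _ := hmark.trans (hle.trans (by simpa using h2))
  have h4 : P.real {ω | t ≤ ‖∑ i, Z i ω‖} ≤
      2 * (Real.exp (n * ((l * B) ^ 2 / 2)) / Real.exp (l * t)) := by
    rw [← mul_div_assoc, le_div_iff₀ (Real.exp_pos _)]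
    linarith
  refine h4.trans (le_of_eq ?_)
  rw [← Real.exp_sub]
  congr 2
  rw [hl]
  field_simp
  ring

end Concentration

/-! ### A positive measure dominating the Stieltjes measure of a path -/

section DominatingMeasure

open Set Filter Topology
open scoped ENNReal

variable {E : Type*} [NormedAddCommGroup E] [CompleteSpace E]

theorem unitInterval.rightLim_one {β : Type*} [TopologicalSpace β] (f : unitInterval → β) :
    f.rightLim 1 = f 1 :=
  rightLim_eq_of_isTop fun _ => unitInterval.le_one'

theorem unitInterval.leftLim_zero {β : Type*} [TopologicalSpace β] (f : unitInterval → β) :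
    f.leftLim 0 = f 0 :=
  leftLim_eq_of_isBot fun _ => unitInterval.nonneg'

theorem unitInterval.Icc_zero_one : Icc (0 : unitInterval) 1 = univ :=
  eq_univ_of_forall fun _ => ⟨unitInterval.nonneg', unitInterval.le_one'⟩

theorem unitInterval.generateFrom_Ioc :
    (inferInstance : MeasurableSpace unitInterval) =
      MeasurableSpace.generateFrom {s | ∃ u v : unitInterval, u ≤ v ∧ s = Ioc u v} := by
  convert! borel_eq_generateFrom_Ioc_le unitInterval using 2
  · exact BorelSpace.measurable_eq
  · grind only

theorem BoundedVariationOn.vectorMeasure_univ_unitInterval {f : unitInterval → E}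
    (hf : BoundedVariationOn f univ) : hf.vectorMeasure univ = f 1 - f 0 := by
  rw [← unitInterval.Icc_zero_one, hf.vectorMeasure_Icc unitInterval.nonneg',
    unitInterval.rightLim_one, unitInterval.leftLim_zero]

/-- The vector measure of a function of bounded variation is dominated by a positive measure whose
mass is the total variation of the function. -/
theorem BoundedVariationOn.exists_measure_norm_vectorMeasure_le {f : unitInterval → E}
    (hf : BoundedVariationOn f univ) :
    ∃ V : Measure unitInterval, IsFiniteMeasure V ∧ V.real univ = (eVariationOn f univ).toReal ∧
      ∀ s, ‖hf.vectorMeasure s‖ ≤ V.real s := by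
  set v : unitInterval → ℝ := variationOnFromTo f univ 0 with hv
  have hmono : Monotone v :=
    monotoneOn_univ.1 (variationOnFromTo.monotoneOn hf.locallyBoundedVariationOn (mem_univ _))
  have hright : ∀ b, v.rightLim b = v b + dist (f b) (f.rightLim b) :=
    fun b => variationOnFromTo.rightLim_eq hf
  have hv0 : v 0 = 0 := variationOnFromTo.self _ _ _
  have hv1 : v 1 = (eVariationOn f univ).toReal := by
    rw [hv, variationOnFromTo.eq_of_le _ _ unitInterval.nonneg', unitInterval.Icc_zero_one,
      inter_univ]
  set F := hmono.stieltjesFunction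
  have hF : ∀ b, F b = v.rightLim b := fun b => rfl
  have hF1 : F 1 = (eVariationOn f univ).toReal := by rw [hF, unitInterval.rightLim_one, hv1]
  have hF0 : F 0 = dist (f 0) (f.rightLim 0) := by rw [hF, hright, hv0, zero_add]
  have hbot : (botSet : Set unitInterval) = {0} :=
    botSet_eq_singleton_of_isBot fun _ => unitInterval.nonneg'
  have hunion : (univ : Set unitInterval) = {0} ∪ Ioc 0 1 := by
    rw [← unitInterval.Icc_zero_one, ← Icc_self, Icc_union_Ioc_eq_Icc le_rfl unitInterval.nonneg']
  have hdisj : Disjoint ({0} : Set unitInterval) (Ioc 0 1) := by simp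
  have hV0 : F.measure {0} = 0 := by rw [← hbot, F.measure_botSet]
  have huniv : F.measure univ = ENNReal.ofReal (F 1 - F 0) := by
    rw [hunion, measure_union hdisj measurableSet_Ioc, hV0, zero_add, F.measure_Ioc]
  have hfin : IsFiniteMeasure F.measure := ⟨by rw [huniv]; exact ENNReal.ofReal_lt_top⟩
  -- The Stieltjes measure of F does not charge 0, so a jump of f at 0 is carried by a separate
  -- Dirac mass. The total mass is (F 1 - F 0) + ‖J‖, which is the total variation because F 0 =
  -- ‖J‖.
  set J : E := f.rightLim 0 - f 0 with hJ
  have hdist : ∀ u w, u ≤ w → ‖f w - f u‖ ≤ v w - v u := fun u w huw => by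
    have h := variationOnFromTo.add hf.locallyBoundedVariationOn (mem_univ 0) (mem_univ u)
      (mem_univ w)
    have h2 : v w - v u = (eVariationOn f (univ ∩ Icc u w)).toReal := by
      rw [← variationOnFromTo.eq_of_le f univ huw]; linarith
    rw [h2, ← dist_eq_norm]
    exact (hf.mono inter_subset_left).dist_le ⟨mem_univ _, huw, le_rfl⟩ ⟨mem_univ _, le_rfl, huw⟩
  have hlim : ∀ u w, u ≤ w → ‖f.rightLim w - f.rightLim u‖ ≤ F w - F u := by
    intro u w huw
    rcases huw.eq_or_lt with rfl | huw
    · simp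
    have hbu : (𝓝[>] u).NeBot := by
      rw [← mem_closure_iff_nhdsWithin_neBot, closure_Ioi' ⟨w, huw⟩]; exact self_mem_Ici
    have hu : Tendsto f (𝓝[>] u) (𝓝 (f.rightLim u)) := hf.tendsto_rightLim u
    have hu' : Tendsto v (𝓝[>] u) (𝓝 (v.rightLim u)) := hmono.tendsto_rightLim u
    have step : ∀ a, u < a → ‖f a - f.rightLim u‖ ≤ v a - v.rightLim u := fun a ha => by
      refine le_of_tendsto_of_tendsto (tendsto_const_nhds.sub hu).norm
        (tendsto_const_nhds.sub hu') ?_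
      filter_upwards [Ioo_mem_nhdsGT ha] with b hb using hdist b a hb.2.le
    -- The filter is trivial at w = 1, where the right limit is the value by convention.
    rcases eq_or_neBot (𝓝[>] w) with hw | hw
    · rw [hF, hF, rightLim_eq_of_eq_bot f hw, rightLim_eq_of_eq_bot v hw]
      exact step w huw
    · refine le_of_tendsto_of_tendsto ((hf.tendsto_rightLim w).sub tendsto_const_nhds).norm
        ((hmono.tendsto_rightLim w).sub tendsto_const_nhds) ?_
      filter_upwards [self_mem_nhdsWithin] with b hb using step b (huw.trans hb)
  obtain ⟨m', hm', hle⟩ :=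
    VectorMeasure.exists_extension_of_isSetSemiring_of_le_measure_of_generateFrom (μ := F.measure)
      (m := AddContent.onIoc f.rightLim) IsSetSemiring.Ioc (by
        rintro s ⟨u, w, huw, rfl⟩
        rw [AddContent.onIoc_apply huw, F.measure_Ioc, ← ofReal_norm]
        exact ENNReal.ofReal_le_ofReal (hlim u w huw)) unitInterval.generateFrom_Ioc
  have hIoc : ∀ u w, u ≤ w → m' (Ioc u w) = f.rightLim w - f.rightLim u := fun u w huw => by
    rw [hm' _ ⟨u, w, huw, rfl⟩, AddContent.onIoc_apply huw]
  have hm0 : m' {0} = 0 := by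
    rw [← enorm_eq_zero, ← nonpos_iff_eq_zero]; exact (hle _).trans hV0.le
  have hM : hf.vectorMeasure = m' + VectorMeasure.dirac 0 J := by
    refine VectorMeasure.ext_of_generateFrom _ ?_ unitInterval.generateFrom_Ioc
      IsSetSemiring.Ioc.isPiSystem ?_
    · rintro s ⟨u, w, huw, rfl⟩
      rw [add_apply, hIoc u w huw, hf.vectorMeasure_Ioc huw,
        VectorMeasure.dirac_apply_of_notMem (by simp), add_zero]
    · rw [add_apply, hf.vectorMeasure_univ_unitInterval,
        VectorMeasure.dirac_apply_of_mem MeasurableSet.univ (mem_univ _), hunion,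
        VectorMeasure.of_union hdisj (measurableSet_singleton _) measurableSet_Ioc, hm0,
        hIoc 0 1 unitInterval.nonneg', unitInterval.rightLim_one, hJ]
      abel
  refine ⟨F.measure + ENNReal.ofReal ‖J‖ • Measure.dirac 0, ?_, ?_, ?_⟩
  · have : IsFiniteMeasure (ENNReal.ofReal ‖J‖ • Measure.dirac (0 : unitInterval)) :=
      Measure.smul_finite _ ENNReal.ofReal_ne_top
    infer_instance
  · have h10 : 0 ≤ F 1 - F 0 := sub_nonneg.2 (F.mono unitInterval.nonneg')
    have : F.measure univ + ENNReal.ofReal ‖J‖ = ENNReal.ofReal (F 1) := by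
      rw [huniv, ← ENNReal.ofReal_add h10 (norm_nonneg _), hF0, hJ, ← dist_eq_norm, dist_comm]
      congr 1; ring
    rw [ofReal_norm] at this
    have hnn : 0 ≤ F 1 := hF1 ▸ ENNReal.toReal_nonneg
    simp [Measure.real, this, ← hF1, ENNReal.toReal_ofReal hnn]
  · intro s
    by_cases hs : MeasurableSet s
    swap
    · rw [VectorMeasure.not_measurable _ hs, norm_zero]; exact measureReal_nonneg
    have hfin' : (F.measure + ENNReal.ofReal ‖J‖ • Measure.dirac (0 : unitInterval)) s ≠ ∞ := by
      simp only [Measure.add_apply, Measure.smul_apply, smul_eq_mul, Measure.dirac_apply' _ hs]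
      refine ENNReal.add_ne_top.2 ⟨measure_ne_top _ _, ENNReal.mul_ne_top ENNReal.ofReal_ne_top ?_⟩
      by_cases h0 : (0 : unitInterval) ∈ s <;> simp [h0]
    rw [← toReal_enorm, Measure.real, ENNReal.toReal_le_toReal (by simp) hfin', hM,
      add_apply]
    refine (enorm_add_le _ _).trans ?_
    simp only [Measure.add_apply, Measure.smul_apply, smul_eq_mul, Measure.dirac_apply' _ hs]
    refine add_le_add (hle s) ?_
    by_cases h0 : (0 : unitInterval) ∈ s
    · rw [VectorMeasure.dirac_apply_of_mem hs h0]; simp [h0]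
    · rw [VectorMeasure.dirac_apply_of_notMem h0]; simp

theorem BoundedVariationOn.vectorMeasure_comp_clm [NormedSpace ℝ E] {G : Type*}
    [NormedAddCommGroup G] [NormedSpace ℝ G] [CompleteSpace G] {f : unitInterval → E}
    (hf : BoundedVariationOn f univ) (L : E →L[ℝ] G)
    (hLf : BoundedVariationOn (fun t => L (f t)) univ) (s : Set unitInterval) :
    hLf.vectorMeasure s = L (hf.vectorMeasure s) := by
  have hright : ∀ a, (fun t => L (f t)).rightLim a = L (f.rightLim a) := fun a => by
    rcases eq_or_neBot (𝓝[>] a) with h | h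
    · rw [rightLim_eq_of_eq_bot _ h, rightLim_eq_of_eq_bot _ h]
    · exact rightLim_eq_of_tendsto ((L.continuous.tendsto _).comp (hf.tendsto_rightLim a))
  have : hLf.vectorMeasure =
      hf.vectorMeasure.mapRange (L : E →ₗ[ℝ] G).toAddMonoidHom L.continuous := by
    refine VectorMeasure.ext_of_generateFrom _ ?_ unitInterval.generateFrom_Ioc
      IsSetSemiring.Ioc.isPiSystem ?_
    · rintro s ⟨u, w, huw, rfl⟩
      change _ = L (hf.vectorMeasure (Ioc u w))
      rw [hf.vectorMeasure_Ioc huw, hLf.vectorMeasure_Ioc huw]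
      simp [hright]
    · change _ = L (hf.vectorMeasure univ)
      rw [hf.vectorMeasure_univ_unitInterval, hLf.vectorMeasure_univ_unitInterval]
      simp
  rw [this]; rfl

end DominatingMeasure

namespace SignatureRegression

open Set Filter Topology

variable {d : ℕ}

theorem coordMeasure_eq (x : BVPath d) (i : Fin d) (s : Set unitInterval) :
    coordMeasure x i s = x.2.vectorMeasure s i :=
  x.2.vectorMeasure_comp_clm (EuclideanSpace.proj i : EuclideanSpace ℝ (Fin d) →L[ℝ] ℝ)
    (coord_boundedVariationOn x i) s

/-- A positive measure dominating the vector-valued Stieltjes measure of a path, with mass the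
total variation of the path. -/
theorem exists_dominatingMeasure (x : BVPath d) :
    ∃ V : Measure unitInterval, IsFiniteMeasure V ∧ V.real univ = totalVariation x ∧
      ∀ s, ‖(WithLp.toLp 2 fun i => coordMeasure x i s : EuclideanSpace ℝ (Fin d))‖ ≤ V.real s := by
  obtain ⟨V, h1, h2, h3⟩ := x.2.exists_measure_norm_vectorMeasure_le
  refine ⟨V, h1, h2, fun s => ?_⟩
  have : WithLp.toLp 2 (fun i => coordMeasure x i s) = x.2.vectorMeasure s := by
    ext i
    exact coordMeasure_eq x i s
  exact this ▸ h3 s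

end SignatureRegression

namespace SignatureRegression

open Set Filter Topology

/-! ### Left-endpoint Riemann sums on regular grids -/

section Riemann

instance (μ : SignedMeasure unitInterval) : IsFiniteMeasure μ.variation := by
  rw [← SignedMeasure.totalVariation_eq_variation, SignedMeasure.totalVariation]
  infer_instance

/-- The index `j` of the cell `(j / (n + 1), (j + 1) / (n + 1)]` which contains `u`, the first cell
being closed. -/
noncomputable def gridIndex (n : ℕ) (u : unitInterval) : ℕ := ⌈(u : ℝ) * (n + 1)⌉₊ - 1

/-- The point `j / (n + 1)` of the regular grid. -/
noncomputable def gridPoint (n j : ℕ) : unitInterval := projIcc 0 1 zero_le_one ((j : ℝ) / (n + 1))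

def gridCell (n j : ℕ) : Set unitInterval := gridIndex n ⁻¹' {j}

theorem measurable_gridIndex (n : ℕ) : Measurable (gridIndex n) :=
  (measurable_from_nat (f := fun j => j - 1)).comp
    (Nat.measurable_ceil.comp (measurable_subtype_coe.mul_const _))

theorem measurableSet_gridCell (n j : ℕ) : MeasurableSet (gridCell n j) :=
  measurable_gridIndex n (measurableSet_singleton j)

theorem gridIndex_lt (n : ℕ) (u : unitInterval) : gridIndex n u < n + 1 := by
  have : ⌈(u : ℝ) * (n + 1)⌉₊ ≤ n + 1 := by
    rw [Nat.ceil_le]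
    push_cast
    exact mul_le_of_le_one_left (by positivity) u.2.2
  unfold gridIndex; omega

theorem coe_gridPoint {n j : ℕ} (hj : j < n + 1) : (gridPoint n j : ℝ) = (j : ℝ) / (n + 1) := by
  have h : (j : ℝ) / (n + 1) ∈ Icc (0 : ℝ) 1 := by
    refine ⟨by positivity, div_le_one_of_le₀ ?_ (by positivity)⟩
    exact_mod_cast hj.le
  rw [gridPoint, projIcc_of_mem _ h]

theorem gridPoint_gridIndex_le (n : ℕ) (u : unitInterval) : gridPoint n (gridIndex n u) ≤ u := by
  rw [← Subtype.coe_le_coe, coe_gridPoint (gridIndex_lt n u), div_le_iff₀ (by positivity)]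
  unfold gridIndex
  rcases Nat.eq_zero_or_pos ⌈(u : ℝ) * (n + 1)⌉₊ with h | h
  · rw [h]; simpa using mul_nonneg u.2.1 (by positivity)
  · exact (Nat.lt_ceil.1 (by omega)).le

theorem le_gridPoint_gridIndex (n : ℕ) (u : unitInterval) :
    (u : ℝ) - 1 / (n + 1) ≤ gridPoint n (gridIndex n u) := by
  rw [coe_gridPoint (gridIndex_lt n u), sub_le_iff_le_add, ← add_div, le_div_iff₀ (by positivity)]
  refine (Nat.le_ceil _).trans ?_
  unfold gridIndex
  exact_mod_cast Nat.le_add_of_sub_le le_rfl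

theorem gridIndex_lt_of_lt_gridPoint {n j : ℕ} (hj : j < n + 1) {u : unitInterval}
    (h : u < gridPoint n j) : gridIndex n u < j := by
  rw [← Subtype.coe_lt_coe, coe_gridPoint hj, lt_div_iff₀ (by positivity)] at h
  have h1 : ⌈(u : ℝ) * (n + 1)⌉₊ ≤ j := Nat.ceil_le.2 h.le
  have h2 : 0 < j := by
    have : (0 : ℝ) < j := (mul_nonneg u.2.1 (by positivity)).trans_lt h
    exact_mod_cast this
  unfold gridIndex; omega

/-- The approach is from the left, which is what left-continuous integrands require. -/
theorem tendsto_gridPoint (u : unitInterval) :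
    Tendsto (fun n => gridPoint n (gridIndex n u)) atTop (𝓝[≤] u) := by
  refine tendsto_nhdsWithin_iff.2 ⟨?_, Eventually.of_forall fun n => gridPoint_gridIndex_le n u⟩
  rw [tendsto_subtype_rng]
  refine tendsto_of_tendsto_of_tendsto_of_le_of_le (g := fun n : ℕ => (u : ℝ) - 1 / (n + 1))
    ?_ tendsto_const_nhds (fun n => le_gridPoint_gridIndex n u)
    (fun n => Subtype.coe_le_coe.2 (gridPoint_gridIndex_le n u))
  simpa using tendsto_const_nhds.sub (tendsto_one_div_add_atTop_nhds_zero_nat (𝕜 := ℝ))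

theorem measurable_of_leftContinuous {f : unitInterval → ℝ}
    (hf : ∀ u, ContinuousWithinAt f (Iic u) u) : Measurable f := by
  refine measurable_of_tendsto_metrizable (f := fun n u => f (gridPoint n (gridIndex n u)))
    (fun n => (measurable_from_nat (f := fun j => f (gridPoint n j))).comp (measurable_gridIndex n))
    (tendsto_pi_nhds.2 fun u => (hf u).tendsto.comp (tendsto_gridPoint u))

/-- The integral of a bounded left-continuous function against a signed measure is a limit of
Riemann sums. -/
theorem tendsto_riemannSum (μ : SignedMeasure unitInterval) {f : unitInterval → ℝ} {C : ℝ}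
    (hb : ∀ u, |f u| ≤ C) (hf : ∀ u, ContinuousWithinAt f (Iic u) u) {S : Set unitInterval}
    (hS : MeasurableSet S) :
    Tendsto (fun n : ℕ => ∑ j ∈ Finset.range (n + 1), f (gridPoint n j) * μ (gridCell n j ∩ S))
      atTop (𝓝 (∫ᵛ u in S, f u ∂•μ)) := by
  have hsum : ∀ n : ℕ, ∑ j ∈ Finset.range (n + 1), f (gridPoint n j) * μ (gridCell n j ∩ S) =
      ∫ᵛ u in S, f (gridPoint n (gridIndex n u)) ∂•μ := fun n => by
    have hind : ∀ u, f (gridPoint n (gridIndex n u)) =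
        ∑ j ∈ Finset.range (n + 1), (gridCell n j).indicator (fun _ => f (gridPoint n j)) u := by
      intro u
      rw [Finset.sum_eq_single_of_mem (gridIndex n u) (Finset.mem_range.2 (gridIndex_lt n u))]
      · rw [indicator_of_mem (by simp [gridCell])]
      · intro j _ hj
        rw [indicator_of_notMem (by simpa [gridCell] using hj.symm)]
    simp_rw [hind]
    rw [VectorMeasure.integral_finsetSum]
    · refine Finset.sum_congr rfl fun j _ => ?_
      rw [VectorMeasure.integral_indicator_const _ (measurableSet_gridCell n j),
        VectorMeasure.restrict_apply _ hS (measurableSet_gridCell n j)]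
      simp
    · intro j _
      exact (integrable_const _).indicator (measurableSet_gridCell n j)
  simp_rw [hsum]
  refine VectorMeasure.tendsto_integral_of_dominated_convergence (fun _ => C) (fun n => ?_)
    (integrable_const _) (fun n => Eventually.of_forall fun u => hb _)
    (Eventually.of_forall fun u => (hf u).tendsto.comp (tendsto_gridPoint u))
  exact ((measurable_from_nat (f := fun j => f (gridPoint n j))).comp
    (measurable_gridIndex n)).aestronglyMeasurable

/-- Dominated convergence: as s increases to t, the indicators of `Iio s` converge pointwise to that
of `Iio t`. With closed intervals an atom at t would break this. -/
theorem continuousWithinAt_setIntegral_Iio (μ : SignedMeasure unitInterval) {f : unitInterval → ℝ}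
    {C : ℝ} (hb : ∀ u, |f u| ≤ C) (hf : Measurable f) (t : unitInterval) :
    ContinuousWithinAt (fun t => ∫ᵛ u in Iio t, f u ∂•μ) (Iic t) t := by
  simp_rw [← VectorMeasure.integral_indicator measurableSet_Iio]
  refine VectorMeasure.tendsto_integral_filter_of_dominated_convergence (fun _ => C)
    (Eventually.of_forall fun s => (hf.indicator measurableSet_Iio).aestronglyMeasurable)
    (Eventually.of_forall fun s => Eventually.of_forall fun u => ?_) (integrable_const _)
    (Eventually.of_forall fun u => ?_)
  · exact (norm_indicator_le_norm_self _ _).trans (hb u)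
  · rcases lt_or_ge u t with hut | hut
    · refine tendsto_const_nhds.congr' ?_
      filter_upwards [mem_nhdsWithin_of_mem_nhds (Ioi_mem_nhds hut)] with s hs
      rw [indicator_of_mem (show u ∈ Iio t from hut), indicator_of_mem (show u ∈ Iio s from hs)]
    · refine tendsto_const_nhds.congr' ?_
      filter_upwards [self_mem_nhdsWithin] with s hs
      rw [indicator_of_notMem (show u ∉ Iio t from not_lt.2 hut),
        indicator_of_notMem (show u ∉ Iio s from not_lt.2 ((show s ≤ t from hs).trans hut))]

end Riemann

/-! ### Factorial decay of the signature -/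

section Bound

variable {d : ℕ}

/-- The vector of all iterated integrals of order `k`. -/
noncomputable def iteratedVector (x : BVPath d) (k : ℕ) (t : unitInterval) :
    EuclideanSpace ℝ (Fin k → Fin d) :=
  WithLp.toLp 2 fun I => iteratedIntegral x k I t

theorem norm_tensor (k : ℕ) (a : (Fin k → Fin d) → ℝ) (b : Fin d → ℝ) :
    ‖(WithLp.toLp 2 fun I : Fin (k + 1) → Fin d => a (Fin.init I) * b (I (Fin.last k)) :
      EuclideanSpace ℝ (Fin (k + 1) → Fin d))‖ =
    ‖(WithLp.toLp 2 a : EuclideanSpace ℝ (Fin k → Fin d))‖ *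
      ‖(WithLp.toLp 2 b : EuclideanSpace ℝ (Fin d))‖ := by
  simp only [EuclideanSpace.norm_eq, Real.norm_eq_abs, sq_abs]
  rw [← Real.sqrt_mul (Finset.sum_nonneg fun _ _ => sq_nonneg _), Finset.sum_mul_sum,
    ← Finset.sum_product']
  congr 1
  refine Fintype.sum_equiv ((Fin.snocEquiv (fun _ : Fin (k + 1) => Fin d)).symm.trans
    (Equiv.prodComm _ _)) _ _ fun I => ?_
  simp [Fin.snocEquiv, mul_pow]

/-- A left-endpoint rectangle for the increasing function (k + 1) x^k lies below its integral over
[p, q]. This replaces the chain rule and tolerates atoms. -/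
theorem mul_pow_mul_sub_le {p q : ℝ} (hp : 0 ≤ p) (hpq : p ≤ q) (k : ℕ) :
    (k + 1) * (p ^ k * (q - p)) ≤ q ^ (k + 1) - p ^ (k + 1) := by
  induction k with
  | zero => simp
  | succ k ih =>
    have hq : 0 ≤ q := hp.trans hpq
    have h1 : p * ((k + 1) * (p ^ k * (q - p))) ≤ q * (q ^ (k + 1) - p ^ (k + 1)) := by
      refine mul_le_mul hpq ih ?_ hq
      have := sub_nonneg.2 hpq
      positivity
    push_cast
    have e1 : p * ((k + 1) * (p ^ k * (q - p))) = (k + 1) * (p ^ (k + 1) * (q - p)) := by ring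
    have e2 : q * (q ^ (k + 1) - p ^ (k + 1)) + p ^ (k + 1) * (q - p) =
        q ^ (k + 1 + 1) - p ^ (k + 1 + 1) := by ring
    linarith

theorem sum_pow_mul_sub_le (a : ℕ → ℝ) (ha : Monotone a) (h0 : 0 ≤ a 0) (k N : ℕ) :
    ∑ j ∈ Finset.range N, a j ^ k / k.factorial * (a (j + 1) - a j) ≤
      a N ^ (k + 1) / (k + 1).factorial := by
  have hnn : ∀ j, 0 ≤ a j := fun j => h0.trans (ha (Nat.zero_le j))
  have step : ∀ j, a j ^ k / k.factorial * (a (j + 1) - a j) ≤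
      a (j + 1) ^ (k + 1) / (k + 1).factorial - a j ^ (k + 1) / (k + 1).factorial := fun j => by
    have h := mul_pow_mul_sub_le (hnn j) (ha j.le_succ) k
    rw [← sub_div, div_mul_eq_mul_div, div_le_div_iff₀ (by positivity) (by positivity),
      Nat.factorial_succ]
    push_cast
    nlinarith [(Nat.cast_pos (α := ℝ)).2 (Nat.factorial_pos k)]
  refine (Finset.sum_le_sum fun j _ => step j).trans ?_
  rw [Finset.sum_range_sub (fun j => a j ^ (k + 1) / (k + 1).factorial)]
  have : 0 ≤ a 0 ^ (k + 1) / ((k + 1).factorial : ℝ) := by have := hnn 0; positivity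
  linarith

theorem abs_iteratedIntegral_le {x : BVPath d} {k : ℕ} (I : Fin k → Fin d) (t : unitInterval) :
    |iteratedIntegral x k I t| ≤ ‖iteratedVector x k t‖ :=
  PiLp.norm_apply_le (iteratedVector x k t) I

/-- In a Riemann sum, each cell contributes a tensor product of the level-k vector at its left
endpoint with the increment of the path. By `hk` its norm is at most a_j^k / k! times a_{j+1} - a_j,
where a_j is the V-mass of the first j cells in S; `sum_pow_mul_sub_le` sums these terms. -/
theorem norm_integral_iteratedIntegral_le {x : BVPath d} {V : Measure unitInterval}
    [IsFiniteMeasure V] (hV : ∀ s, ‖(WithLp.toLp 2 fun i => coordMeasure x i s :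
      EuclideanSpace ℝ (Fin d))‖ ≤ V.real s) {k : ℕ}
    (hk : ∀ t, ‖iteratedVector x k t‖ ≤ V.real (Iio t) ^ k / k.factorial)
    (hc : ∀ I t, ContinuousWithinAt (iteratedIntegral x k I) (Iic t) t)
    {S : Set unitInterval} (hS : MeasurableSet S) (hS' : IsLowerSet S) :
    ‖(WithLp.toLp 2 fun I : Fin (k + 1) → Fin d => ∫ᵛ u in S,
      iteratedIntegral x k (Fin.init I) u ∂•(coordMeasure x (I (Fin.last k))) :
        EuclideanSpace ℝ (Fin (k + 1) → Fin d))‖ ≤ V.real S ^ (k + 1) / (k + 1).factorial := by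
  have hb : ∀ I t, |iteratedIntegral x k I t| ≤ V.real univ ^ k / k.factorial := fun I t =>
    (abs_iteratedIntegral_le I t).trans ((hk t).trans (by gcongr ?_ ^ k / _; exact measureReal_mono (subset_univ _)))
  have hlim : Tendsto (fun n : ℕ => (WithLp.toLp 2 fun I : Fin (k + 1) → Fin d =>
      ∑ j ∈ Finset.range (n + 1), iteratedIntegral x k (Fin.init I) (gridPoint n j) *
        coordMeasure x (I (Fin.last k)) (gridCell n j ∩ S) :
        EuclideanSpace ℝ (Fin (k + 1) → Fin d))) atTop
      (𝓝 (WithLp.toLp 2 fun I : Fin (k + 1) → Fin d => ∫ᵛ u in S,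
        iteratedIntegral x k (Fin.init I) u ∂•(coordMeasure x (I (Fin.last k))))) :=
    ((PiLp.continuous_toLp 2 _).tendsto _).comp (tendsto_pi_nhds.2 fun I =>
      tendsto_riemannSum _ (hb _) (hc _) hS)
  refine le_of_tendsto hlim.norm (Eventually.of_forall fun n => ?_)
  set a : ℕ → ℝ := fun j => V.real (gridIndex n ⁻¹' Set.Iio j ∩ S) with ha
  have hmono : Monotone a := fun i j hij => measureReal_mono (by gcongr)
  have hdiff : ∀ j, V.real (gridCell n j ∩ S) = a (j + 1) - a j := fun j => by
    have hdisj : Disjoint (gridIndex n ⁻¹' Set.Iio j ∩ S) (gridCell n j ∩ S) := by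
      refine Set.disjoint_left.2 fun u hu hu' => ?_
      have h1 : gridIndex n u < j := hu.1
      have h2 : gridIndex n u = j := hu'.1
      omega
    have hun : gridIndex n ⁻¹' Set.Iio (j + 1) ∩ S =
        (gridIndex n ⁻¹' Set.Iio j ∩ S) ∪ (gridCell n j ∩ S) := by
      rw [← Set.union_inter_distrib_right]
      congr 1
      ext u
      simp only [mem_preimage, mem_Iio, mem_union, gridCell, mem_singleton_iff]
      omega
    simp only [ha]
    rw [hun, measureReal_union hdisj ((measurableSet_gridCell n j).inter hS)]
    ring
  have hcell : ∀ j ∈ Finset.range (n + 1),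
      ‖iteratedVector x k (gridPoint n j)‖ * V.real (gridCell n j ∩ S) ≤
        a j ^ k / k.factorial * (a (j + 1) - a j) := fun j hj => by
    rw [← hdiff]
    rcases (gridCell n j ∩ S).eq_empty_or_nonempty with he | ⟨u, hu, huS⟩
    · simp [he]
    · refine mul_le_mul_of_nonneg_right ((hk _).trans ?_) measureReal_nonneg
      -- A cell meeting the lower set S has everything before its left endpoint in S.
      have hsub : Iio (gridPoint n j) ⊆ gridIndex n ⁻¹' Set.Iio j ∩ S := fun w hw => by
        refine ⟨gridIndex_lt_of_lt_gridPoint (Finset.mem_range.1 hj) hw, hS' ?_ huS⟩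
        have hu' : gridIndex n u = j := hu
        exact (le_of_lt hw).trans (hu' ▸ gridPoint_gridIndex_le n u)
      have := measureReal_mono (μ := V) hsub
      gcongr
  calc _ = ‖∑ j ∈ Finset.range (n + 1), (WithLp.toLp 2 fun I : Fin (k + 1) → Fin d =>
      iteratedIntegral x k (Fin.init I) (gridPoint n j) *
        coordMeasure x (I (Fin.last k)) (gridCell n j ∩ S) :
        EuclideanSpace ℝ (Fin (k + 1) → Fin d))‖ := by
        congr 1
        ext I
        simp
    _ ≤ ∑ j ∈ Finset.range (n + 1),
        ‖iteratedVector x k (gridPoint n j)‖ * V.real (gridCell n j ∩ S) := by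
        refine norm_sum_le_of_le _ fun j _ => ?_
        rw [norm_tensor k (fun I => iteratedIntegral x k I (gridPoint n j))
          (fun i => coordMeasure x i (gridCell n j ∩ S))]
        exact mul_le_mul_of_nonneg_left (hV _) (norm_nonneg _)
    _ ≤ _ := Finset.sum_le_sum hcell
    _ ≤ _ := sum_pow_mul_sub_le a hmono measureReal_nonneg k (n + 1)
    _ ≤ _ := by
        gcongr ?_ ^ (k + 1) / _
        exact measureReal_mono inter_subset_right

/-- The two claims are proved together: the bound at the next level uses Riemann sums, which need
left-continuity of the present level. -/
theorem iteratedIntegral_bound_and_leftContinuous {x : BVPath d} {V : Measure unitInterval}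
    [IsFiniteMeasure V] (hV : ∀ s, ‖(WithLp.toLp 2 fun i => coordMeasure x i s :
      EuclideanSpace ℝ (Fin d))‖ ≤ V.real s) (k : ℕ) :
    (∀ t, ‖iteratedVector x k t‖ ≤ V.real (Iio t) ^ k / k.factorial) ∧
      ∀ I t, ContinuousWithinAt (iteratedIntegral x k I) (Iic t) t := by
  induction k with
  | zero =>
    refine ⟨fun t => ?_, fun I t => continuousWithinAt_const⟩
    simp [iteratedVector, iteratedIntegral, EuclideanSpace.norm_eq]
  | succ k ih =>
    obtain ⟨hk, hc⟩ := ih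
    refine ⟨fun t => norm_integral_iteratedIntegral_le hV hk hc measurableSet_Iio
      (isLowerSet_Iio t), fun I t => ?_⟩
    exact continuousWithinAt_setIntegral_Iio _ (C := V.real univ ^ k / k.factorial)
      (fun t => (abs_iteratedIntegral_le _ t).trans ((hk t).trans (by gcongr ?_ ^ k / _; exact measureReal_mono (subset_univ _))))
      (measurable_of_leftContinuous (hc _)) t

theorem leftContinuous_iteratedIntegral (x : BVPath d) (k : ℕ) (I : Fin k → Fin d)
    (t : unitInterval) : ContinuousWithinAt (iteratedIntegral x k I) (Iic t) t := by
  obtain ⟨V, _, -, hV⟩ := exists_dominatingMeasure x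
  exact (iteratedIntegral_bound_and_leftContinuous hV k).2 I t

theorem exists_abs_iteratedIntegral_le (x : BVPath d) (k : ℕ) :
    ∃ C, ∀ (I : Fin k → Fin d) (t : unitInterval), |iteratedIntegral x k I t| ≤ C := by
  obtain ⟨V, _, -, hV⟩ := exists_dominatingMeasure x
  exact ⟨V.real univ ^ k / k.factorial, fun I t => (abs_iteratedIntegral_le I t).trans
    (((iteratedIntegral_bound_and_leftContinuous hV k).1 t).trans
      (by gcongr ?_ ^ k / _; exact measureReal_mono (subset_univ _)))⟩

theorem norm_sigCoeff_le (x : BVPath d) (k : ℕ) :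
    ‖(WithLp.toLp 2 fun I : Fin k → Fin d => sigCoeff x k I :
      EuclideanSpace ℝ (Fin k → Fin d))‖ ≤ totalVariation x ^ k / k.factorial := by
  obtain ⟨V, _, hVu, hV⟩ := exists_dominatingMeasure x
  rcases k with _ | k
  · simp [sigCoeff, EuclideanSpace.norm_eq]
  · obtain ⟨hk, hc⟩ := iteratedIntegral_bound_and_leftContinuous hV k
    have := norm_integral_iteratedIntegral_le hV hk hc MeasurableSet.univ isLowerSet_univ
    rw [hVu] at this
    simpa [sigCoeff] using this

theorem totalVariation_nonneg (x : BVPath d) : 0 ≤ totalVariation x := ENNReal.toReal_nonneg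

/-- The factorial decay of the signature bounds its Euclidean norm. -/
theorem norm_truncSig_le (m : ℕ) (x : BVPath d) : ‖truncSig m x‖ ≤ Real.exp (totalVariation x) := by
  have hTV := totalVariation_nonneg x
  refine le_trans ?_ (Real.sum_le_exp_of_nonneg hTV (m + 1))
  refine abs_le_of_sq_le_sq' ?_ (Finset.sum_nonneg fun k _ => by positivity) |>.2
  calc ‖truncSig m x‖ ^ 2
      = ∑ k : Fin (m + 1), ‖(WithLp.toLp 2 fun I : Fin k → Fin d => sigCoeff x k I :
          EuclideanSpace ℝ (Fin k → Fin d))‖ ^ 2 := by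
        simp_rw [EuclideanSpace.norm_sq_eq]
        rw [Fintype.sum_sigma]
        rfl
    _ ≤ ∑ k : Fin (m + 1), (totalVariation x ^ (k : ℕ) / (k : ℕ).factorial) ^ 2 := by
        gcongr with k
        exact norm_sigCoeff_le x k
    _ = ∑ k ∈ Finset.range (m + 1), (totalVariation x ^ k / k.factorial) ^ 2 :=
        (Finset.sum_range fun k => (totalVariation x ^ k / k.factorial) ^ 2).symm
    _ ≤ _ := Finset.sum_sq_le_sq_sum_of_nonneg fun k _ => by positivity

end Bound

/-! ### Measurability of the signature -/

section Measurability

variable {d : ℕ}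

theorem measurable_eval_coord (i : Fin d) (a : unitInterval) :
    Measurable fun x : BVPath d => x.1 a i :=
  (EuclideanSpace.proj i : EuclideanSpace ℝ (Fin d) →L[ℝ] ℝ).continuous.measurable.comp
    ((measurable_pi_apply a).comp measurable_subtype_coe)

/-- One sequence decreasing to a serves all paths, so the right limit is a pointwise limit of
evaluations. -/
theorem measurable_rightLim_coord (i : Fin d) (a : unitInterval) :
    Measurable fun x : BVPath d => (fun t => x.1 t i).rightLim a := by
  rcases eq_or_neBot (𝓝[>] a) with h | h
  · simp_rw [rightLim_eq_of_eq_bot _ h]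
    exact measurable_eval_coord i a
  · obtain ⟨u, hu⟩ := exists_seq_tendsto (𝓝[>] a)
    refine measurable_of_tendsto_metrizable (fun n => measurable_eval_coord i (u n))
      (tendsto_pi_nhds.2 fun x => ?_)
    exact ((coord_boundedVariationOn x i).tendsto_rightLim a).comp hu

theorem measurable_coordMeasure (i : Fin d) {s : Set unitInterval} (hs : MeasurableSet s) :
    Measurable fun x : BVPath d => coordMeasure x i s := by
  have huniv : Measurable fun x : BVPath d => coordMeasure x i univ := by
    simp_rw [coordMeasure, BoundedVariationOn.vectorMeasure_univ_unitInterval]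
    exact (measurable_eval_coord i 1).sub (measurable_eval_coord i 0)
  induction s, hs using MeasurableSpace.induction_on_inter unitInterval.generateFrom_Ioc
    IsSetSemiring.Ioc.isPiSystem with
  | empty => simp
  | basic s hs =>
    obtain ⟨u, w, huw, rfl⟩ := hs
    simp_rw [coordMeasure, BoundedVariationOn.vectorMeasure_Ioc _ huw]
    exact (measurable_rightLim_coord i w).sub (measurable_rightLim_coord i u)
  | compl s hs ih =>
    have : ∀ x : BVPath d, coordMeasure x i sᶜ = coordMeasure x i univ - coordMeasure x i s :=
      fun x => by rw [← VectorMeasure.of_add_of_sdiff hs MeasurableSet.univ (subset_univ s),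
        compl_eq_univ_sdiff]; ring
    simp_rw [this]
    exact huniv.sub ih
  | iUnion f hd hm ih =>
    refine measurable_of_tendsto_metrizable
      (fun n => Finset.measurable_fun_sum (Finset.range n) fun j _ => ih j)
      (tendsto_pi_nhds.2 fun x => ?_)
    exact ((coordMeasure x i).hasSum_of_disjoint_iUnion hm hd).tendsto_sum_nat

/-- The Riemann sums see the path only through values at fixed grid points and masses of fixed
cells. -/
theorem measurable_setIntegral_iteratedIntegral {k : ℕ} {I : Fin k → Fin d}
    (hI : ∀ t, Measurable fun x : BVPath d => iteratedIntegral x k I t) (i : Fin d)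
    {S : Set unitInterval} (hS : MeasurableSet S) :
    Measurable fun x : BVPath d => ∫ᵛ u in S, iteratedIntegral x k I u ∂•(coordMeasure x i) := by
  refine measurable_of_tendsto_metrizable (f := fun (n : ℕ) (x : BVPath d) =>
    ∑ j ∈ Finset.range (n + 1), iteratedIntegral x k I (gridPoint n j) *
      coordMeasure x i (gridCell n j ∩ S)) (fun n => ?_) (tendsto_pi_nhds.2 fun x => ?_)
  rotate_left 1
  · obtain ⟨C, hC⟩ := exists_abs_iteratedIntegral_le x k
    exact tendsto_riemannSum (coordMeasure x i) (hC I) (leftContinuous_iteratedIntegral x k I) hS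
  · exact Finset.measurable_fun_sum _ fun j _ => (hI _).mul
      (measurable_coordMeasure i ((measurableSet_gridCell n j).inter hS))

theorem measurable_iteratedIntegral (k : ℕ) (I : Fin k → Fin d) (t : unitInterval) :
    Measurable fun x : BVPath d => iteratedIntegral x k I t := by
  induction k generalizing t with
  | zero => exact measurable_const
  | succ k ih => exact measurable_setIntegral_iteratedIntegral (fun t => ih _ t) _ measurableSet_Iio

theorem measurable_sigCoeff (k : ℕ) (I : Fin k → Fin d) :
    Measurable fun x : BVPath d => sigCoeff x k I := by
  rcases k with _ | k
  · exact measurable_const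
  · have := measurable_setIntegral_iteratedIntegral
      (fun t => measurable_iteratedIntegral k (Fin.init I) t) (I (Fin.last k)) MeasurableSet.univ
    simpa [sigCoeff] using this

theorem measurable_truncSig (m : ℕ) : Measurable (truncSig m : BVPath d → SigSpace d m) :=
  (PiLp.continuous_toLp 2 _).measurable.comp
    (measurable_pi_lambda _ fun I => measurable_sigCoeff I.1 I.2)

end Measurability

end SignatureRegression

namespace SignatureRegression

/-! ### Linearisation of the quadratic loss -/

section Feature

variable {ι : Type*} [Fintype ι]

/-- The vector of all products `s_i (y / α)` and `s_i s_j`: differences of quadratic losses are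
linear in it. -/
noncomputable def lossFeature (α y : ℝ) (s : EuclideanSpace ℝ ι) :
    EuclideanSpace ℝ (ι × Option ι) :=
  WithLp.toLp 2 fun p => s p.1 * p.2.elim (y / α) s

/-- The vector representing the difference of the losses of `β` and `β'`. -/
noncomputable def lossDirection (α : ℝ) (β β' : EuclideanSpace ℝ ι) :
    EuclideanSpace ℝ (ι × Option ι) :=
  WithLp.toLp 2 fun p =>
    p.2.elim (-2 * α * (β p.1 - β' p.1)) fun j => β p.1 * β j - β' p.1 * β' j

theorem real_inner_eq_sum (x y : EuclideanSpace ℝ ι) :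
    inner ℝ x y = ∑ i, x i * y i := by
  simp [PiLp.inner_apply, mul_comm]

theorem inner_lossDirection {α : ℝ} (hα : α ≠ 0) (y : ℝ) (s β β' : EuclideanSpace ℝ ι) :
    inner ℝ (lossDirection α β β') (lossFeature α y s) =
      (y - inner ℝ β s) ^ 2 - (y - inner ℝ β' s) ^ 2 := by
  have h1 : ∀ b : EuclideanSpace ℝ ι, (inner ℝ b s) ^ 2 =
      ∑ i, ∑ j, b i * b j * (s i * s j) := fun b => by
    rw [real_inner_eq_sum, sq, Finset.sum_mul_sum]
    refine Finset.sum_congr rfl fun i _ => Finset.sum_congr rfl fun j _ => by ring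
  have h2 : ∀ b : EuclideanSpace ℝ ι, ∑ i, b i * (s i * y) = inner ℝ b s * y := fun b => by
    rw [real_inner_eq_sum, Finset.sum_mul]
    exact Finset.sum_congr rfl fun i _ => by ring
  have h3 : (y - inner ℝ β s) ^ 2 - (y - inner ℝ β' s) ^ 2 =
      -2 * (inner ℝ β s * y - inner ℝ β' s * y) +
        ((inner ℝ β s) ^ 2 - (inner ℝ β' s) ^ 2) := by ring
  rw [h3, h1, h1, ← h2, ← h2, ← Finset.sum_sub_distrib, ← Finset.sum_sub_distrib, Finset.mul_sum,
    ← Finset.sum_add_distrib, real_inner_eq_sum, Fintype.sum_prod_type]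
  refine Finset.sum_congr rfl fun i _ => ?_
  rw [Fintype.sum_option, ← Finset.sum_sub_distrib]
  congr 1
  · simp only [lossDirection, lossFeature, Option.elim]
    field_simp
  · exact Finset.sum_congr rfl fun j _ => by
      simp only [lossDirection, lossFeature, Option.elim]; ring

/-- The feature is the tensor s ⊗ (y/α, s), so its squared norm is ‖s‖² ((y/α)² + ‖s‖²), whatever
the dimension. -/
theorem norm_lossFeature_le {α y K e : ℝ} (hα : 0 < α) {s : EuclideanSpace ℝ ι} (hy : |y| ≤ K)
    (hs : ‖s‖ ≤ e) : ‖lossFeature α y s‖ ≤ (K + α * e) * e / α := by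
  have he : 0 ≤ e := (norm_nonneg s).trans hs
  have hK : 0 ≤ K := (abs_nonneg y).trans hy
  refine abs_le_of_sq_le_sq' ?_ (by positivity) |>.2
  have h : ‖lossFeature α y s‖ ^ 2 = ‖s‖ ^ 2 * ((y / α) ^ 2 + ‖s‖ ^ 2) := by
    simp only [EuclideanSpace.norm_sq_eq, Real.norm_eq_abs, sq_abs]
    rw [Fintype.sum_prod_type, Finset.sum_mul]
    refine Finset.sum_congr rfl fun i _ => ?_
    rw [Fintype.sum_option, mul_add, Finset.mul_sum]
    simp [lossFeature, mul_pow]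
  have hy2 : (y / α) ^ 2 ≤ (K / α) ^ 2 := by
    rw [← sq_abs (y / α), abs_div, abs_of_pos hα]; gcongr
  calc _ = ‖s‖ ^ 2 * ((y / α) ^ 2 + ‖s‖ ^ 2) := h
    _ ≤ e ^ 2 * ((K / α) ^ 2 + e ^ 2) := by gcongr
    _ ≤ e ^ 2 * (K / α + e) ^ 2 := by
        gcongr
        have : 0 ≤ K / α * e := by positivity
        nlinarith
    _ = _ := by field_simp

/-- Applying (a - b)² ≤ 2 (a² + b²) to every entry gives a squared norm of at most 20 α⁴, rounded up
to 25 α⁴. Dividing y by α in the feature makes both blocks of the direction of order α². -/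
theorem norm_lossDirection_le {α : ℝ} (hα : 0 < α) {β β' : EuclideanSpace ℝ ι} (hβ : ‖β‖ ≤ α)
    (hβ' : ‖β'‖ ≤ α) : ‖lossDirection α β β'‖ ≤ 5 * α ^ 2 := by
  refine abs_le_of_sq_le_sq' ?_ (by positivity) |>.2
  have h : ‖lossDirection α β β'‖ ^ 2 ≤
      ∑ i, (8 * α ^ 2 * (β i ^ 2 + β' i ^ 2) +
        ∑ j, 2 * (β i ^ 2 * β j ^ 2 + β' i ^ 2 * β' j ^ 2)) := by
    simp only [EuclideanSpace.norm_sq_eq, Real.norm_eq_abs, sq_abs]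
    rw [Fintype.sum_prod_type]
    refine Finset.sum_le_sum fun i _ => ?_
    rw [Fintype.sum_option]
    refine add_le_add ?_ (Finset.sum_le_sum fun j _ => ?_)
    · simp only [lossDirection, Option.elim]
      nlinarith [mul_nonneg (sq_nonneg α) (sq_nonneg (β i + β' i))]
    · simp only [lossDirection, Option.elim]
      nlinarith [sq_nonneg (β i * β j + β' i * β' j)]
  have h2 : ∑ i, (8 * α ^ 2 * (β i ^ 2 + β' i ^ 2) +
      ∑ j, 2 * (β i ^ 2 * β j ^ 2 + β' i ^ 2 * β' j ^ 2)) =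
      8 * α ^ 2 * (‖β‖ ^ 2 + ‖β'‖ ^ 2) + 2 * (‖β‖ ^ 2 * ‖β‖ ^ 2 + ‖β'‖ ^ 2 * ‖β'‖ ^ 2) := by
    simp only [EuclideanSpace.norm_sq_eq, Real.norm_eq_abs, sq_abs]
    simp only [Finset.sum_add_distrib, Finset.sum_mul_sum, ← Finset.mul_sum, mul_add]
  have b1 : ‖β‖ ^ 2 ≤ α ^ 2 := by gcongr
  have b2 : ‖β'‖ ^ 2 ≤ α ^ 2 := by gcongr
  calc _ ≤ _ := h
    _ = _ := h2
    _ ≤ 8 * α ^ 2 * (α ^ 2 + α ^ 2) + 2 * (α ^ 2 * α ^ 2 + α ^ 2 * α ^ 2) := by gcongr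
    _ ≤ _ := by nlinarith [sq_nonneg (α ^ 2)]

theorem measurable_lossFeature (α : ℝ) :
    Measurable fun p : ℝ × EuclideanSpace ℝ ι => lossFeature α p.1 p.2 := by
  refine (PiLp.continuous_toLp 2 _).measurable.comp (measurable_pi_lambda _ fun p => ?_)
  have h : ∀ i : ι, Measurable fun p : ℝ × EuclideanSpace ℝ ι => p.2 i := fun i =>
    (EuclideanSpace.proj i : EuclideanSpace ℝ ι →L[ℝ] ℝ).continuous.measurable.comp measurable_snd
  rcases p with ⟨i, _ | j⟩
  · exact (h i).mul (measurable_fst.div_const α)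
  · exact (h i).mul (h j)

end Feature

/-! ### Uniform deviation of risk differences -/

section Deviation

variable {d : ℕ} {Ω₀ Ω : Type*} [MeasurableSpace Ω₀] [MeasurableSpace Ω] {μ : Measure Ω₀}
  {P : Measure Ω} [IsProbabilityMeasure P] {X : Ω₀ → BVPath d}
  {Y : Ω₀ → ℝ} {KX KY α : ℝ}

theorem norm_truncSig_le_exp (hXb : ∀ᵐ ω ∂μ, totalVariation (X ω) ≤ KX) (m : ℕ) :
    ∀ᵐ ω ∂μ, ‖truncSig m (X ω)‖ ≤ Real.exp KX := by
  filter_upwards [hXb] with ω hω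
  exact (norm_truncSig_le m _).trans (Real.exp_le_exp.2 hω)

theorem integrable_loss [IsFiniteMeasure μ] (hX : Measurable X) (hY : Measurable Y)
    (hYb : ∀ᵐ ω ∂μ, |Y ω| ≤ KY) (hXb : ∀ᵐ ω ∂μ, totalVariation (X ω) ≤ KX) (m : ℕ)
    (β : SigSpace d m) :
    Integrable (fun ω => (Y ω - inner ℝ β (truncSig m (X ω))) ^ 2) μ := by
  refine Integrable.of_bound (C := (KY + ‖β‖ * Real.exp KX) ^ 2)
    ((hY.sub (((measurable_truncSig m).comp hX).const_inner)).pow_const 2).aestronglyMeasurable ?_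
  filter_upwards [hYb, norm_truncSig_le_exp hXb m] with ω h1 h2
  rw [norm_pow]
  gcongr
  refine (norm_sub_le _ _).trans (add_le_add h1 ((norm_inner_le_norm _ _).trans ?_))
  gcongr

/-- Uniform deviation of the differences of empirical risks. -/
theorem measureReal_exists_deviation_le [IsProbabilityMeasure μ] (hX : Measurable X) (hY : Measurable Y) (hα : 0 < α)
    (hKY : 0 < KY) (hYb : ∀ᵐ ω ∂μ, |Y ω| ≤ KY)
    (hXb : ∀ᵐ ω ∂μ, totalVariation (X ω) ≤ KX) {n : ℕ} (hn : 0 < n)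
    {Xs : Fin n → Ω → BVPath d} {Ys : Fin n → Ω → ℝ}
    (hindep : iIndepFun (fun i ω => (Xs i ω, Ys i ω)) P)
    (hident : ∀ i, IdentDistrib (fun ω => (Xs i ω, Ys i ω)) (fun ω => (X ω, Y ω)) P μ)
    (m : ℕ) {D : ℝ} (hD : 0 < D) :
    P.real {ω | ∃ β β' : SigSpace d m, ‖β‖ ≤ α ∧ ‖β'‖ ≤ α ∧
      D ≤ |(empRisk (fun i => Xs i ω) (fun i => Ys i ω) m β -
          empRisk (fun i => Xs i ω) (fun i => Ys i ω) m β') -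
        (risk μ X Y m β - risk μ X Y m β')|} ≤
      2 * Real.exp (-(n * D ^ 2 / (50 * constK α KX KY ^ 2 * α ^ 2))) := by
  set e := Real.exp KX with he
  have he0 : 0 < e := Real.exp_pos _
  have hK : 0 < constK α KX KY := by unfold constK; positivity
  -- b = K / (2α), so the centred features have norm at most 2b = K / α.
  set b := (KY + α * e) * e / α with hb
  have hb0 : 0 < b := by positivity
  let φ : BVPath d × ℝ → EuclideanSpace ℝ (MultiIndex d m × Option (MultiIndex d m)) :=
    fun p => lossFeature α p.2 (truncSig m p.1)
  have hφ : Measurable φ := (measurable_lossFeature α).comp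
    (measurable_snd.prodMk ((measurable_truncSig m).comp measurable_fst))
  have hXY : Measurable fun ω => (X ω, Y ω) := hX.prodMk hY
  have hφb : ∀ᵐ ω ∂μ, ‖φ (X ω, Y ω)‖ ≤ b := by
    filter_upwards [hYb, norm_truncSig_le_exp hXb m] with ω h1 h2
    exact norm_lossFeature_le hα h1 h2
  have hφint : Integrable (fun ω => φ (X ω, Y ω)) μ :=
    Integrable.of_bound (hφ.comp hXY).aestronglyMeasurable b hφb
  set w := ∫ ω, φ (X ω, Y ω) ∂μ with hw
  have hwb : ‖w‖ ≤ b := by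
    simpa using norm_integral_le_of_norm_le_const (μ := μ) hφb
  let ψ : BVPath d × ℝ → EuclideanSpace ℝ (MultiIndex d m × Option (MultiIndex d m)) :=
    fun p => φ p - w
  have hψ : Measurable ψ := hφ.sub_const w
  have hψid : ∀ i, IdentDistrib (fun ω => ψ (Xs i ω, Ys i ω)) (fun ω => ψ (X ω, Y ω)) P μ :=
    fun i => (hident i).comp hψ
  have hψb : ∀ᵐ ω ∂μ, ‖ψ (X ω, Y ω)‖ ≤ 2 * b := by
    filter_upwards [hφb] with ω h
    exact (norm_sub_le _ _).trans (by linarith)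
  have hconc := measureReal_norm_sum_ge_le (P := P) (Z := fun i ω => ψ (Xs i ω, Ys i ω))
    (fun i => (hψid i).aemeasurable_fst) (hindep.comp (fun _ => ψ) fun _ => hψ)
    (B := 2 * b) (by positivity)
    (fun i => (hψid i).symm.ae_snd (p := fun z => ‖z‖ ≤ 2 * b)
      (measurableSet_le measurable_norm measurable_const) hψb)
    (fun i => by
      rw [(hψid i).integral_eq, integral_sub hφint (integrable_const _)]
      simp [hw])
    -- Directions have norm at most 5α², so a deviation D forces the centred sum to have norm at
    -- least this t; then t² / (2n (K/α)²) = nD² / (50 K² α²).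
    (by simpa using hn) (t := n * D / (5 * α ^ 2)) (by positivity)
  refine (measureReal_mono ?_).trans (hconc.trans (le_of_eq ?_))
  · rintro ω ⟨β, β', h1, h2, h3⟩
    have hemp : empRisk (fun i => Xs i ω) (fun i => Ys i ω) m β -
        empRisk (fun i => Xs i ω) (fun i => Ys i ω) m β' =
        (1 / (n : ℝ)) * ∑ i, inner ℝ (lossDirection α β β') (φ (Xs i ω, Ys i ω)) := by
      simp only [empRisk, φ, inner_lossDirection hα.ne', Finset.sum_sub_distrib]
      ring
    have hrisk : risk μ X Y m β - risk μ X Y m β' = inner ℝ (lossDirection α β β') w := by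
      rw [hw, ← integral_inner hφint]
      simp only [φ, inner_lossDirection hα.ne']
      exact (integral_sub (integrable_loss hX hY hYb hXb m β)
        (integrable_loss hX hY hYb hXb m β')).symm
    have hdiff : (1 / (n : ℝ)) * ∑ i, inner ℝ (lossDirection α β β') (φ (Xs i ω, Ys i ω)) -
        inner ℝ (lossDirection α β β') w =
        (1 / (n : ℝ)) * inner ℝ (lossDirection α β β') (∑ i, ψ (Xs i ω, Ys i ω)) := by
      simp only [ψ, Finset.sum_sub_distrib, inner_sub_right, inner_sum]
      simp
      field_simp
    rw [hemp, hrisk, hdiff, abs_mul, abs_of_pos (by positivity : 0 < 1 / (n : ℝ))] at h3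
    have h4 := (abs_real_inner_le_norm (lossDirection α β β') (∑ i, ψ (Xs i ω, Ys i ω))).trans
      (mul_le_mul_of_nonneg_right (norm_lossDirection_le hα h1 h2) (norm_nonneg _))
    have hn' : (0 : ℝ) < n := by exact_mod_cast hn
    change n * D / (5 * α ^ 2) ≤ _
    rw [div_le_iff₀ (by positivity)]
    rw [one_div, inv_mul_eq_div, le_div_iff₀ hn'] at h3
    linarith
  · have hn' : (n : ℝ) ≠ 0 := by exact_mod_cast hn.ne'
    have hne : KY + α * e ≠ 0 := by positivity
    simp only [Fintype.card_fin, constK, hb, ← he]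
    congr 2
    field_simp
    ring

end Deviation

end SignatureRegression

namespace SignatureRegression

/-! ### Comparison of truncation orders by zero extension -/

section Padding

variable {d m M : ℕ}

def castMultiIndex (h : m ≤ M) (I : MultiIndex d m) : MultiIndex d M :=
  ⟨Fin.castLE (Nat.succ_le_succ h) I.1, I.2⟩

theorem castMultiIndex_injective (h : m ≤ M) :
    Function.Injective (castMultiIndex (d := d) h) := by
  rintro ⟨k, f⟩ ⟨k', f'⟩ hk
  simp only [castMultiIndex, Sigma.mk.injEq, Fin.castLE_inj] at hk
  obtain ⟨rfl, hf⟩ := hk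
  simpa using hf

/-- Extension of a coefficient vector by zero to the multi-indices of higher order. -/
noncomputable def padSig (h : m ≤ M) (β : SigSpace d m) : SigSpace d M :=
  WithLp.toLp 2 (Function.extend (castMultiIndex h) β 0)

theorem padSig_cast (h : m ≤ M) (β : SigSpace d m) (I : MultiIndex d m) :
    padSig h β (castMultiIndex h I) = β I :=
  (castMultiIndex_injective h).extend_apply _ _ _

theorem padSig_of_notMem (h : m ≤ M) (β : SigSpace d m) {J : MultiIndex d M}
    (hJ : J ∉ Set.range (castMultiIndex h)) : padSig h β J = 0 := by
  rw [padSig]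
  exact Function.extend_apply' _ _ _ hJ

theorem norm_padSig (h : m ≤ M) (β : SigSpace d m) : ‖padSig h β‖ = ‖β‖ := by
  rw [EuclideanSpace.norm_eq, EuclideanSpace.norm_eq]
  congr 1
  refine (Fintype.sum_of_injective (castMultiIndex h) (castMultiIndex_injective h) _ _ ?_ ?_).symm
  · intro J hJ; simp [padSig_of_notMem h β hJ]
  · intro I; rw [padSig_cast]

theorem inner_padSig (h : m ≤ M) (β : SigSpace d m) (x : BVPath d) :
    inner ℝ (padSig h β) (truncSig M x) = inner ℝ β (truncSig m x) := by
  rw [real_inner_eq_sum, real_inner_eq_sum]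
  refine (Fintype.sum_of_injective (castMultiIndex h) (castMultiIndex_injective h) _ _ ?_ ?_).symm
  · intro J hJ; simp [padSig_of_notMem h β hJ]
  · intro I; rw [padSig_cast]; rfl

theorem empRisk_padSig {n : ℕ} (h : m ≤ M) (x : Fin n → BVPath d) (y : Fin n → ℝ)
    (β : SigSpace d m) : empRisk x y M (padSig h β) = empRisk x y m β := by
  simp [empRisk, inner_padSig]

theorem risk_padSig {Ω : Type*} [MeasurableSpace Ω] (μ : Measure Ω) (X : Ω → BVPath d)
    (Y : Ω → ℝ) (h : m ≤ M) (β : SigSpace d m) :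
    risk μ X Y M (padSig h β) = risk μ X Y m β := by
  simp [risk, inner_padSig]

end Padding

/-! ### The true risk -/

section Population

variable {d : ℕ} {Ω : Type*} [MeasurableSpace Ω] {μ : Measure Ω} {X : Ω → BVPath d} {Y : Ω → ℝ}
  {α KX KY σ : ℝ}

theorem risk_nonneg (m : ℕ) (β : SigSpace d m) : 0 ≤ risk μ X Y m β :=
  integral_nonneg fun _ => sq_nonneg _

theorem minRisk_le_risk {m M : ℕ} (h : m ≤ M) {β : SigSpace d m} (hβ : ‖β‖ ≤ α) :
    minRisk μ X Y α M ≤ risk μ X Y m β := by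
  rw [← risk_padSig μ X Y h β]
  refine csInf_le ⟨0, ?_⟩ ⟨padSig h β, by simpa [norm_padSig] using hβ, rfl⟩
  rintro _ ⟨b, -, rfl⟩
  exact risk_nonneg _ _

theorem minRisk_le_sq [IsProbabilityMeasure μ] (hα : 0 ≤ α) (hYb : ∀ᵐ ω ∂μ, |Y ω| ≤ KY) (m : ℕ) :
    minRisk μ X Y α m ≤ KY ^ 2 := by
  refine (minRisk_le_risk (le_refl m) (β := 0) (by simpa using hα)).trans ?_
  have h : ∀ᵐ ω ∂μ, ‖(Y ω - inner ℝ (0 : SigSpace d m) (truncSig m (X ω))) ^ 2‖ ≤ KY ^ 2 := by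
    filter_upwards [hYb] with ω hω
    rw [inner_zero_left, sub_zero, norm_pow]
    exact pow_le_pow_left₀ (norm_nonneg _) hω 2
  simpa [risk] using (le_abs_self _).trans (norm_integral_le_of_norm_le_const h)

variable [IsProbabilityMeasure μ] {mstar : ℕ} {βstar : SigSpace d mstar}

/-- The conditional expectation minimises the quadratic risk. -/
theorem risk_le_risk_of_condExp (hX : Measurable X) (hY : Measurable Y)
    (hβstar : μ[Y | MeasurableSpace.comap X inferInstance] =ᵐ[μ]
      fun ω => inner ℝ βstar (truncSig mstar (X ω)))
    (hYb : ∀ᵐ ω ∂μ, |Y ω| ≤ KY) (hXb : ∀ᵐ ω ∂μ, totalVariation (X ω) ≤ KX) (m : ℕ)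
    (β : SigSpace d m) : risk μ X Y mstar βstar ≤ risk μ X Y m β := by
  set f : Ω → ℝ := fun ω => inner ℝ βstar (truncSig mstar (X ω)) with hf
  set g : Ω → ℝ := fun ω => inner ℝ β (truncSig m (X ω)) with hg
  have hcomap : MeasurableSpace.comap X inferInstance ≤ (inferInstance : MeasurableSpace Ω) :=
    hX.comap_le
  have hmeas : ∀ {k : ℕ} (b : SigSpace d k),
      Measurable[MeasurableSpace.comap X inferInstance] fun ω => inner ℝ b (truncSig k (X ω)) :=
    fun b => ((measurable_truncSig _).const_inner (c := b)).comp (comap_measurable X)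
  have hbound : ∀ {k : ℕ} (b : SigSpace d k),
      ∀ᵐ ω ∂μ, ‖(inner ℝ b (truncSig k (X ω)) : ℝ)‖ ≤ ‖b‖ * Real.exp KX := fun b => by
    filter_upwards [norm_truncSig_le_exp hXb _] with ω hω
    exact (norm_inner_le_norm _ _).trans (by gcongr)
  have hYint : Integrable Y μ := Integrable.of_bound hY.aestronglyMeasurable KY hYb
  have hint : ∀ {k : ℕ} (b : SigSpace d k), Integrable (fun ω => inner ℝ b (truncSig k (X ω))) μ :=
    fun b => Integrable.of_bound ((hmeas b).mono hcomap le_rfl).aestronglyMeasurable _ (hbound b)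
  have hfg : StronglyMeasurable[MeasurableSpace.comap X inferInstance] (f - g) :=
    ((hmeas βstar).sub (hmeas β)).stronglyMeasurable
  have hfgb : ∀ᵐ ω ∂μ, ‖(f - g) ω‖ ≤ ‖βstar‖ * Real.exp KX + ‖β‖ * Real.exp KX := by
    filter_upwards [hbound βstar, hbound β] with ω h1 h2
    exact (norm_sub_le _ _).trans (add_le_add h1 h2)
  have hYf : Integrable (Y - f) μ := hYint.sub (hint βstar)
  have hprod : Integrable ((f - g) * (Y - f)) μ :=
    hYf.bdd_mul (hfg.mono hcomap).aestronglyMeasurable hfgb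
  have hcond : μ[Y - f | MeasurableSpace.comap X inferInstance] =ᵐ[μ] 0 := by
    refine (condExp_sub hYint (hint βstar) _).trans ?_
    have hff : μ[f | MeasurableSpace.comap X inferInstance] = f :=
      condExp_of_stronglyMeasurable hcomap (hmeas βstar).stronglyMeasurable (hint βstar)
    rw [hff]
    filter_upwards [hβstar] with ω hω
    simp [hω, hf]
  -- Orthogonality: f - g is a function of X, and Y - f has zero conditional mean given X.
  have hzero : ∫ ω, ((f - g) * (Y - f)) ω ∂μ = 0 := by
    rw [← integral_condExp hcomap]
    have h1 := condExp_mul_of_stronglyMeasurable_left hfg hprod hYf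
    refine integral_eq_zero_of_ae ?_
    filter_upwards [h1, hcond] with ω h1 h2
    rw [h1, Pi.mul_apply, h2]; simp
  have hloss := integrable_loss hX hY hYb hXb mstar βstar
  have hmono : ∫ ω, ((Y ω - f ω) ^ 2 + 2 * ((f - g) * (Y - f)) ω) ∂μ ≤
      ∫ ω, (Y ω - g ω) ^ 2 ∂μ := by
    refine integral_mono (hloss.add (hprod.const_mul 2)) (integrable_loss hX hY hYb hXb m β)
      fun ω => ?_
    simp only [Pi.mul_apply, Pi.sub_apply]
    nlinarith [sq_nonneg (f ω - g ω)]
  rw [integral_add hloss (hprod.const_mul 2), integral_const_mul, hzero, mul_zero, add_zero] at hmono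
  exact hmono

/-- The residual at β* is Y minus its conditional mean, so the risk is the integral of the
conditional variance. -/
theorem risk_le_of_condVar_le (hX : Measurable X) (hY : Measurable Y)
    (hβstar : μ[Y | MeasurableSpace.comap X inferInstance] =ᵐ[μ]
      fun ω => inner ℝ βstar (truncSig mstar (X ω)))
    (hYb : ∀ᵐ ω ∂μ, |Y ω| ≤ KY) (hXb : ∀ᵐ ω ∂μ, totalVariation (X ω) ≤ KX)
    (hσ : ∀ᵐ ω ∂μ, Var[Y; μ | MeasurableSpace.comap X inferInstance] ω ≤ σ ^ 2) :
    risk μ X Y mstar βstar ≤ σ ^ 2 := by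
  have hcomap : MeasurableSpace.comap X inferInstance ≤ (inferInstance : MeasurableSpace Ω) :=
    hX.comap_le
  have hae : (fun ω => (Y ω - inner ℝ βstar (truncSig mstar (X ω))) ^ 2) =ᵐ[μ]
      (Y - μ[Y | MeasurableSpace.comap X inferInstance]) ^ 2 := by
    filter_upwards [hβstar] with ω hω
    simp [hω]
  have hint : Integrable ((Y - μ[Y | MeasurableSpace.comap X inferInstance]) ^ 2) μ :=
    (integrable_loss hX hY hYb hXb mstar βstar).congr hae
  have h1 := setIntegral_condVar (hm := hcomap) hint MeasurableSet.univ
  simp only [Measure.restrict_univ] at h1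
  calc risk μ X Y mstar βstar
      = ∫ ω, ((Y - μ[Y | MeasurableSpace.comap X inferInstance]) ^ 2) ω ∂μ := integral_congr_ae hae
    _ = ∫ ω, Var[Y; μ | MeasurableSpace.comap X inferInstance] ω ∂μ := h1.symm
    _ ≤ ∫ _, σ ^ 2 ∂μ := integral_mono_ae integrable_condVar (integrable_const _) hσ
    _ = σ ^ 2 := by simp

end Population

/-! ### Existence of a minimising order -/

section Estimator

variable {d n : ℕ} {α Kpen ρ : ℝ} (x : Fin n → BVPath d) (y : Fin n → ℝ)

theorem empRisk_nonneg (m : ℕ) (β : SigSpace d m) : 0 ≤ empRisk x y m β := by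
  unfold empRisk; positivity

theorem minEmpRisk_le {m : ℕ} {β : SigSpace d m} (hβ : ‖β‖ ≤ α) :
    minEmpRisk α x y m ≤ empRisk x y m β := by
  refine csInf_le ⟨0, ?_⟩ ⟨β, by simpa using hβ, rfl⟩
  rintro _ ⟨b, -, rfl⟩
  exact empRisk_nonneg _ _ _ _

theorem exists_empRisk_eq_minEmpRisk (hα : 0 ≤ α) (m : ℕ) :
    ∃ β : SigSpace d m, ‖β‖ ≤ α ∧ empRisk x y m β = minEmpRisk α x y m := by
  have hc : Continuous (empRisk x y m) := by unfold empRisk; fun_prop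
  obtain ⟨β, hβ, h⟩ := (isCompact_closedBall (0 : SigSpace d m) α).exists_sInf_image_eq
    (Metric.nonempty_closedBall.2 hα) hc.continuousOn
  exact ⟨β, by simpa using hβ, h.symm⟩

theorem succ_le_sigDim (hd : 2 ≤ d) (m : ℕ) : m + 1 ≤ sigDim d m := by
  calc m + 1 = ∑ k ∈ Finset.range (m + 1), 1 := by simp
    _ ≤ sigDim d m := Finset.sum_le_sum fun k _ => Nat.one_le_pow _ _ (by omega)

theorem sigDim_mono (d : ℕ) : Monotone (sigDim d) := fun _ _ h =>
  Finset.sum_le_sum_of_subset (Finset.range_mono (Nat.succ_le_succ h))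

/-- If the estimated order is wrong, another order does at least as well as the true one. -/
theorem exists_le_of_mHat_ne (hd : 2 ≤ d) (hn : 0 < n) (hKpen : 0 < Kpen) (hα : 0 ≤ α) {k : ℕ}
    (h : mHat α Kpen ρ x y ≠ k) :
    ∃ m ≠ k, minEmpRisk α x y m + pen d Kpen ρ n m ≤ minEmpRisk α x y k + pen d Kpen ρ n k := by
  have hc : 0 < Kpen * (n : ℝ) ^ (-ρ) :=
    mul_pos hKpen (Real.rpow_pos_of_pos (Nat.cast_pos.2 hn) _)
  have htend : Filter.Tendsto (fun m => minEmpRisk α x y m + pen d Kpen ρ n m)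
      Filter.cofinite Filter.atTop := by
    rw [Nat.cofinite_eq_atTop]
    refine Filter.tendsto_atTop_mono (f := fun m : ℕ => Kpen * (n : ℝ) ^ (-ρ) * √(m : ℝ))
      (fun m => ?_) ((Filter.tendsto_atTop_atTop_of_monotone (fun a b h => Real.sqrt_le_sqrt h)
        (fun b => ⟨b ^ 2, Real.le_sqrt_of_sq_le le_rfl⟩)).comp
          tendsto_natCast_atTop_atTop |>.const_mul_atTop hc)
    obtain ⟨β, -, hβ⟩ := exists_empRisk_eq_minEmpRisk x y hα m
    have h0 := hβ ▸ empRisk_nonneg x y m β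
    have h1 : (m : ℝ) ≤ sigDim d m := by
      exact_mod_cast (Nat.le_succ m).trans (succ_le_sigDim hd m)
    have : Kpen * (n : ℝ) ^ (-ρ) * √(m : ℝ) ≤ pen d Kpen ρ n m := by unfold pen; gcongr
    linarith
  -- The penalty diverges, so a minimiser exists; for an empty set `sInf` would return 0 and carry
  -- no information.
  have hne : {m | ∀ k, minEmpRisk α x y m + pen d Kpen ρ n m ≤
      minEmpRisk α x y k + pen d Kpen ρ n k}.Nonempty := htend.exists_forall_le
  exact ⟨_, h, Nat.sInf_mem hne k⟩

end Estimator

end SignatureRegression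

namespace SignatureRegression

/-! ### Arithmetic of the constants -/

section Constants

variable {d : ℕ} {α KX KY Kpen ρ gap : ℝ} {mstar : ℕ}

theorem constK_pos (hα : 0 < α) (hKY : 0 < KY) : 0 < constK α KX KY := by
  unfold constK; positivity

theorem one_le_sigDim (d m : ℕ) : 1 ≤ sigDim d m := by
  rw [sigDim, Finset.sum_range_succ', pow_zero]; exact Nat.le_add_left 1 _

theorem sigDim_succ (d m : ℕ) : sigDim d (m + 1) = sigDim d m + d ^ (m + 1) :=
  Finset.sum_range_succ _ _

theorem sigDim_le_pow (hd : 2 ≤ d) (m : ℕ) : sigDim d m ≤ d ^ (m + 1) :=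
  (Nat.geomSum_lt hd fun _ hk => Finset.mem_range.1 hk).le

theorem const3_pos (hd : 2 ≤ d) (hKY : 0 < KY) (hKpen : 0 < Kpen) (K : ℝ) :
    0 < const3 d α K KY Kpen mstar := by
  have h1 : (0 : ℝ) < d := by exact_mod_cast (by omega : 0 < d)
  have h2 : (0 : ℝ) < sigDim d (mstar + 1) := by exact_mod_cast one_le_sigDim d (mstar + 1)
  unfold const3; positivity

theorem summable_exp_neg_mul_sigDim (hd : 2 ≤ d) {c : ℝ} (hc : 0 < c) :
    Summable fun m : ℕ => Real.exp (-c * (sigDim d (m + 1) : ℝ)) := by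
  refine Summable.of_nonneg_of_le (fun _ => (Real.exp_pos _).le) (fun m => ?_)
    (Real.summable_exp_nat_mul_iff.2 (neg_lt_zero.2 hc))
  have h : (m : ℝ) ≤ sigDim d (m + 1) := by
    exact_mod_cast (by have := succ_le_sigDim hd (m + 1); omega : m ≤ sigDim d (m + 1))
  refine Real.exp_le_exp.2 ?_
  nlinarith

/-- Growth of the penalty beyond the true order. -/
theorem sqrt_sigDim_sub_sq (hd : 2 ≤ d) {m : ℕ} (hm : mstar < m) :
    (d : ℝ) ^ (mstar + 1) / sigDim d (mstar + 1) * sigDim d m / 8 ≤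
        (√(sigDim d m : ℝ) - √(sigDim d mstar : ℝ)) ^ 2 ∧
      0 < √(sigDim d m : ℝ) - √(sigDim d mstar : ℝ) := by
  have hd0 : (0 : ℝ) < d := by exact_mod_cast (by omega : 0 < d)
  have hu : ((sigDim d (mstar + 1) : ℕ) : ℝ) = sigDim d mstar + (d : ℝ) ^ (mstar + 1) := by
    exact_mod_cast sigDim_succ d mstar
  have ht : ((sigDim d mstar : ℕ) : ℝ) ≤ (d : ℝ) ^ (mstar + 1) := by
    exact_mod_cast sigDim_le_pow hd mstar
  have hs : ((sigDim d (mstar + 1) : ℕ) : ℝ) ≤ sigDim d m := by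
    exact_mod_cast sigDim_mono d hm
  have ht1 : (1 : ℝ) ≤ sigDim d mstar := by exact_mod_cast one_le_sigDim d mstar
  generalize (sigDim d mstar : ℝ) = t at *
  generalize (sigDim d (mstar + 1) : ℝ) = u at *
  generalize (sigDim d m : ℝ) = s at *
  have hp : 0 < (d : ℝ) ^ (mstar + 1) := by positivity
  generalize (d : ℝ) ^ (mstar + 1) = p at *
  have hu0 : 0 < u := by linarith
  have hs0 : 0 < s := by linarith
  -- Here t = u (1 - q) ≤ s (1 - q), and √(1 - q) ≤ 1 - q/2 gives √s - √t ≥ √s q/2. Since q ≥ 1/2,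
  -- the square s q²/4 is at least s q/8.
  set q := p / u with hq
  have hq1 : q ≤ 1 := by rw [hq, div_le_one hu0]; linarith
  have hq2 : 1 / 2 ≤ q := by rw [hq, le_div_iff₀ hu0]; linarith
  have htq : t ≤ s * (1 - q) := by
    have : t = u * (1 - q) := by rw [hq]; field_simp; linarith
    rw [this]
    exact mul_le_mul_of_nonneg_right hs (by linarith)
  have hsqrt : √t ≤ √s * (1 - q / 2) := by
    refine Real.sqrt_le_iff.2 ⟨mul_nonneg (Real.sqrt_nonneg _) (by linarith), ?_⟩
    rw [mul_pow, Real.sq_sqrt hs0.le]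
    nlinarith [mul_nonneg hs0.le (sq_nonneg q)]
  have hlow : √s * q / 2 ≤ √s - √t := by linarith
  have hpos : 0 < √s * q / 2 := by have := Real.sqrt_pos.2 hs0; positivity
  refine ⟨?_, hpos.trans_le hlow⟩
  calc q * s / 8 ≤ (√s * q / 2) ^ 2 := by
        rw [div_pow, mul_pow, Real.sq_sqrt hs0.le]
        nlinarith [mul_pos hs0 (by linarith : 0 < q)]
    _ ≤ _ := pow_le_pow_left₀ hpos.le hlow 2

theorem natCast_rpow_split {n : ℕ} (hn : 0 < n) (ρ : ℝ) :
    (n : ℝ) * ((n : ℝ) ^ (-ρ)) ^ 2 = (n : ℝ) ^ (1 - 2 * ρ) := by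
  have hn' : (0 : ℝ) < n := Nat.cast_pos.2 hn
  rw [← Real.rpow_natCast, ← Real.rpow_mul hn'.le]
  nth_rewrite 1 [← Real.rpow_one (n : ℝ)]
  rw [← Real.rpow_add hn']
  congr 1; push_cast; ring

/-- With N = n^(1-2ρ) and s = s_d(m), the right side is at least A N s / 400. As N, s ≥ 1, the
product N s dominates both s and N, and the coefficients A / 9216 and A / 147456 on the left add up
to less than A / 400. -/
theorem exponent_of_larger_order (hd : 2 ≤ d) (hα : 0 < α) {K : ℝ} (hK : 0 < K) (hKY : 0 < KY)
    (hKpen : 0 < Kpen) (hρ' : ρ < 1 / 2) {n : ℕ} (hn : 0 < n) {m : ℕ} (hm : mstar < m) :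
    const3 d α K KY Kpen mstar * sigDim d m +
        const2 d α K KY Kpen gap mstar * (n : ℝ) ^ (1 - 2 * ρ) ≤
      n * (pen d Kpen ρ n m - pen d Kpen ρ n mstar) ^ 2 / (50 * K ^ 2 * α ^ 2) := by
  obtain ⟨hsq, -⟩ := sqrt_sigDim_sub_sq hd hm
  have hd0 : (0 : ℝ) < d := by exact_mod_cast (by omega : 0 < d)
  have hn1 : (1 : ℝ) ≤ n := by exact_mod_cast hn
  have hN : 1 ≤ (n : ℝ) ^ (1 - 2 * ρ) := Real.one_le_rpow hn1 (by linarith)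
  have hsplit := natCast_rpow_split hn ρ
  have hs1 : (1 : ℝ) ≤ sigDim d m := by exact_mod_cast one_le_sigDim d m
  have hu0 : (0 : ℝ) < sigDim d (mstar + 1) := by exact_mod_cast one_le_sigDim d (mstar + 1)
  set q := (d : ℝ) ^ (mstar + 1) / sigDim d (mstar + 1) with hq
  have hq0 : 0 < q := by positivity
  set N := (n : ℝ) ^ (1 - 2 * ρ)
  set s : ℝ := ((sigDim d m : ℕ) : ℝ)
  set A := Kpen ^ 2 * q / (K ^ 2 * α ^ 2) with hA
  have hA0 : 0 < A := by positivity
  have h3 : const3 d α K KY Kpen mstar ≤ A / 9216 := by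
    calc const3 d α K KY Kpen mstar
        = Kpen ^ 2 * q / (128 * (72 * K ^ 2 * α ^ 2 + KY ^ 2)) := by
          rw [const3, hq]; field_simp
      _ ≤ Kpen ^ 2 * q / (128 * (72 * K ^ 2 * α ^ 2)) := by
          gcongr; linarith [sq_nonneg KY]
      _ = A / 9216 := by rw [hA]; field_simp; norm_num
  have h2 : const2 d α K KY Kpen gap mstar ≤ A / 147456 := by
    calc const2 d α K KY Kpen gap mstar
        ≤ 1 / (16 * (1152 * K ^ 2 * α ^ 2 + KY ^ 2)) *
            (Kpen ^ 2 * (d : ℝ) ^ (mstar + 1) / (8 * sigDim d (mstar + 1))) := by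
          unfold const2
          gcongr
          split_ifs
          · exact le_rfl
          · exact min_le_left _ _
      _ ≤ 1 / (16 * (1152 * K ^ 2 * α ^ 2)) *
            (Kpen ^ 2 * (d : ℝ) ^ (mstar + 1) / (8 * sigDim d (mstar + 1))) := by
          gcongr; linarith [sq_nonneg KY]
      _ = A / 147456 := by rw [hA, hq]; field_simp; norm_num
  have hrhs : A * (N * s) / 400 ≤
      n * (pen d Kpen ρ n m - pen d Kpen ρ n mstar) ^ 2 / (50 * K ^ 2 * α ^ 2) := by
    have e : n * (pen d Kpen ρ n m - pen d Kpen ρ n mstar) ^ 2 =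
        Kpen ^ 2 * N * (√(sigDim d m : ℝ) - √(sigDim d mstar : ℝ)) ^ 2 := by
      rw [← hsplit]; unfold pen; ring
    rw [e]
    calc A * (N * s) / 400 = Kpen ^ 2 * N * (q * s / 8) / (50 * K ^ 2 * α ^ 2) := by
          rw [hA]; field_simp; norm_num
      _ ≤ _ := by gcongr
  have hNs : s ≤ N * s := le_mul_of_one_le_left (by linarith) hN
  have hNs' : N ≤ N * s := le_mul_of_one_le_right (by linarith) hs1
  have a1 : const3 d α K KY Kpen mstar * s ≤ A / 9216 * (N * s) :=
    mul_le_mul h3 hNs (by linarith) (by positivity)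
  have a2 : const2 d α K KY Kpen gap mstar * N ≤ A / 147456 * (N * s) :=
    mul_le_mul h2 hNs' (by linarith) (by positivity)
  have a3 : 0 < A * (N * s) := by positivity
  linarith

/-- Since n^min(ρ, 1/2-ρ) ≤ n^ρ, the threshold gives n^ρ gap ≥ 2 Kpen √s_d(m*+1) and n^ρ gap ≥ 864 K
α. The first bounds the penalty. The second makes the deviation exponent exceed n^(1-2ρ) / 16, while
gap ≤ K_Y² forces C₂ ≤ 1/16. -/
theorem pen_le_half_gap_and_exponent (hα : 0 < α) {K : ℝ} (hK : 0 < K) (hKY : 0 < KY)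
    (hKpen : 0 < Kpen) (hgap : 0 < gap) (hgapY : gap ≤ KY ^ 2) {n : ℕ} (hn : 0 < n)
    (hmstar : mstar ≠ 0)
    (hthr : sampleThreshold d α K Kpen gap mstar ≤ (n : ℝ) ^ min ρ (1 / 2 - ρ)) :
    pen d Kpen ρ n mstar ≤ gap / 2 ∧
      const2 d α K KY Kpen gap mstar * (n : ℝ) ^ (1 - 2 * ρ) ≤
        n * (gap / 2) ^ 2 / (50 * K ^ 2 * α ^ 2) := by
  have hn1 : (1 : ℝ) ≤ n := by exact_mod_cast hn
  have hn0 : (0 : ℝ) < n := by linarith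
  set u : ℝ := ((sigDim d (mstar + 1) : ℕ) : ℝ) with hu
  have hu1 : 1 ≤ u := by rw [hu]; exact_mod_cast one_le_sigDim d (mstar + 1)
  have hsu : √(sigDim d mstar : ℝ) ≤ √u :=
    Real.sqrt_le_sqrt (by rw [hu]; exact_mod_cast sigDim_mono d (Nat.le_succ mstar))
  have hsu1 : 1 ≤ √u := Real.one_le_sqrt.2 hu1
  have hpi : 1 ≤ √Real.pi := Real.one_le_sqrt.2 (by linarith [Real.pi_gt_three])
  set r := (n : ℝ) ^ ρ with hr
  have hr0 : 0 < r := Real.rpow_pos_of_pos hn0 _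
  have hkey : (432 * K * α * √Real.pi + Kpen) * (2 * √u) ≤ r * gap := by
    rw [← div_le_iff₀ hgap, mul_div_assoc]
    refine le_trans ?_ (hthr.trans (Real.rpow_le_rpow_of_exponent_le hn1 (min_le_left _ _)))
    unfold sampleThreshold
    rw [if_neg hmstar]
    refine mul_le_mul_of_nonneg_left (le_add_of_nonneg_right ?_) (by positivity)
    positivity
  have hk1 : Kpen * (2 * √u) ≤ r * gap := by
    refine le_trans ?_ hkey
    gcongr
    have : 0 ≤ 432 * K * α * √Real.pi := by positivity
    linarith
  have hk2 : 864 * (K * α) ≤ r * gap := by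
    refine le_trans ?_ hkey
    have : 432 * (K * α) * 1 ≤ 432 * K * α * √Real.pi + Kpen := by nlinarith [mul_pos hK hα]
    calc 864 * (K * α) = 432 * (K * α) * 1 * (2 * 1) := by ring
      _ ≤ _ := by gcongr
  have hrinv : (n : ℝ) ^ (-ρ) = r⁻¹ := Real.rpow_neg hn0.le _
  refine ⟨?_, ?_⟩
  · rw [pen, hrinv]
    have : Kpen * √(sigDim d mstar : ℝ) ≤ r * gap / 2 := by nlinarith
    calc Kpen * r⁻¹ * √(sigDim d mstar : ℝ) = r⁻¹ * (Kpen * √(sigDim d mstar : ℝ)) := by ring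
      _ ≤ r⁻¹ * (r * gap / 2) := by gcongr
      _ = gap / 2 := by field_simp
  · have hsplit := natCast_rpow_split hn ρ
    rw [hrinv] at hsplit
    rw [← hsplit]
    have hc2 : const2 d α K KY Kpen gap mstar ≤ 1 / 16 := by
      calc const2 d α K KY Kpen gap mstar
          ≤ 1 / (16 * (1152 * K ^ 2 * α ^ 2 + KY ^ 2)) * gap := by
            unfold const2
            rw [if_neg hmstar]
            gcongr
            exact min_le_right _ _
        _ ≤ 1 / (16 * KY ^ 2) * KY ^ 2 := by
            gcongr
            have : 0 ≤ 1152 * K ^ 2 * α ^ 2 := by positivity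
            linarith
        _ = 1 / 16 := by field_simp
    have hsq : (864 * (K * α)) ^ 2 ≤ (r * gap) ^ 2 := by gcongr
    have hratio : 1 / 16 ≤ (r * gap) ^ 2 / (200 * (K * α) ^ 2) := by
      rw [div_le_div_iff₀ (by norm_num) (by positivity)]
      nlinarith [mul_pos hK hα]
    calc const2 d α K KY Kpen gap mstar * (n * r⁻¹ ^ 2)
        ≤ (r * gap) ^ 2 / (200 * (K * α) ^ 2) * (n * r⁻¹ ^ 2) :=
          mul_le_mul_of_nonneg_right (hc2.trans hratio) (by positivity)
      _ = _ := by field_simp; norm_num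

/-- The threshold is positive even when m* = 0, thanks to its second fraction, whereas 0 to a
positive power is 0. -/
theorem pos_of_sampleThreshold_le (hd : 2 ≤ d) (hα : 0 < α) {K : ℝ} (hK : 0 < K)
    (hKpen : 0 < Kpen) (hgap : mstar ≠ 0 → 0 < gap) (hρ : 0 < ρ) (hρ' : ρ < 1 / 2) {n : ℕ}
    (hthr : sampleThreshold d α K Kpen gap mstar ≤ (n : ℝ) ^ min ρ (1 / 2 - ρ)) : 0 < n := by
  have hd0 : (0 : ℝ) < d := by exact_mod_cast (by omega : 0 < d)
  have hu0 : (0 : ℝ) < sigDim d (mstar + 1) := by exact_mod_cast one_le_sigDim d (mstar + 1)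
  have hpos : 0 < sampleThreshold d α K Kpen gap mstar := by
    unfold sampleThreshold
    refine mul_pos (by positivity) (add_pos_of_nonneg_of_pos ?_ (by positivity))
    split_ifs with h
    · exact le_rfl
    · have := hgap h; positivity
  rcases Nat.eq_zero_or_pos n with rfl | h
  · have hmin : 0 < min ρ (1 / 2 - ρ) := lt_min hρ (by linarith)
    rw [Nat.cast_zero, Real.zero_rpow hmin.ne'] at hthr
    linarith
  · exact h

end Constants

end SignatureRegression

/-! ### Union bound and conclusion -/

namespace SignatureRegression

theorem measureReal_iUnion_le_tsum {Ω : Type*} [MeasurableSpace Ω] {P : Measure Ω}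
    [IsFiniteMeasure P] {A : ℕ → Set Ω} {a : ℕ → ℝ} (ha : Summable a)
    (h : ∀ j, P.real (A j) ≤ a j) : P.real (⋃ j, A j) ≤ ∑' j, a j := by
  have h0 : ∀ j, 0 ≤ a j := fun j => measureReal_nonneg.trans (h j)
  refine ENNReal.toReal_le_of_le_ofReal (tsum_nonneg h0) ?_
  rw [ENNReal.ofReal_tsum_of_nonneg h0 ha]
  refine (measure_iUnion_le _).trans (ENNReal.tsum_le_tsum fun j => ?_)
  rw [← ofReal_measureReal]
  exact ENNReal.ofReal_le_ofReal (h j)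

end SignatureRegression

theorem theorem1
    -- the law of the random couple `(X, Y)`
    {Ω₀ : Type*} [MeasurableSpace Ω₀] (μ : Measure Ω₀) [IsProbabilityMeasure μ]
    (d : ℕ) (hd : 2 ≤ d) (X : Ω₀ → BVPath d) (hX : Measurable X) (Y : Ω₀ → ℝ) (hY : Measurable Y)
    -- the signature linear model, with smallest truncation order `mstar`
    (mstar : ℕ)
    (hmstar : IsLeast {m : ℕ | ∃ β : SigSpace d m,
      μ[Y | MeasurableSpace.comap X inferInstance] =ᵐ[μ] fun ω => inner ℝ β (truncSig m (X ω))}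
      mstar)
    (σ : ℝ) (hσ : ∀ᵐ ω ∂μ, Var[Y; μ | MeasurableSpace.comap X inferInstance] ω ≤ σ ^ 2)
    -- the true coefficient lies in the ball of radius `α`
    (α : ℝ) (hα : 0 < α) (βstar : SigSpace d mstar)
    (hβstar : μ[Y | MeasurableSpace.comap X inferInstance] =ᵐ[μ]
      fun ω => inner ℝ βstar (truncSig mstar (X ω)))
    (hβα : ‖βstar‖ ≤ α)
    -- almost sure bounds on `Y` and on the total variation of `X`
    (KX KY : ℝ) (hKX : 0 < KX) (hKY : 0 < KY)
    (hYb : ∀ᵐ ω ∂μ, |Y ω| ≤ KY) (hXb : ∀ᵐ ω ∂μ, totalVariation (X ω) ≤ KX)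
    -- `L(mstar - 1) - σ²` is positive (no condition when `mstar = 0`)
    (hgap : mstar ≠ 0 → σ ^ 2 < minRisk μ X Y α (mstar - 1))
    -- the penalty
    (Kpen ρ : ℝ) (hKpen : 0 < Kpen) (hρ : 0 < ρ) (hρ' : ρ < 1 / 2)
    -- the sample size
    (n₀ : ℕ)
    (hn₀ : IsLeast {N : ℕ |
      sampleThreshold d α (constK α KX KY) Kpen (minRisk μ X Y α (mstar - 1) - σ ^ 2) mstar
        ≤ (N : ℝ) ^ min ρ (1 / 2 - ρ)} n₀)
    (n : ℕ) (hn : n₀ ≤ n)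
    -- an i.i.d. sample of size `n` of the law of `(X, Y)`
    {Ω : Type*} [MeasurableSpace Ω] (P : Measure Ω) [IsProbabilityMeasure P]
    (Xs : Fin n → Ω → BVPath d) (Ys : Fin n → Ω → ℝ)
    (hindep : iIndepFun (fun i ω => (Xs i ω, Ys i ω)) P)
    (hident : ∀ i, IdentDistrib (fun ω => (Xs i ω, Ys i ω)) (fun ω => (X ω, Y ω)) P μ) :
    -- the series in `C₁` converges
    Summable (fun m : ℕ => Real.exp (-const3 d α (constK α KX KY) KY Kpen mstar *
      (sigDim d (m + 1) : ℝ))) ∧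
    P.real {ω | mHat α Kpen ρ (fun i => Xs i ω) (fun i => Ys i ω) ≠ mstar} ≤
      const1 d α (constK α KX KY) KY Kpen mstar *
        Real.exp (-const2 d α (constK α KX KY) KY Kpen
          (minRisk μ X Y α (mstar - 1) - σ ^ 2) mstar * (n : ℝ) ^ (1 - 2 * ρ)) := by
  set K := constK α KX KY with hKdef
  -- For m* = 0 the truncated subtraction turns this into L(0) - σ², a value that the threshold and
  -- C₂ both discard.
  set gap := minRisk μ X Y α (mstar - 1) - σ ^ 2 with hgapdef
  set E := Real.exp (-const2 d α K KY Kpen gap mstar * (n : ℝ) ^ (1 - 2 * ρ)) with hE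
  have hK : 0 < K := constK_pos hα hKY
  have hgap0 : mstar ≠ 0 → 0 < gap := fun h => sub_pos.2 (hgap h)
  have hr0 : 0 ≤ min ρ (1 / 2 - ρ) := le_min hρ.le (by linarith)
  have hthr : sampleThreshold d α K Kpen gap mstar ≤ (n : ℝ) ^ min ρ (1 / 2 - ρ) :=
    hn₀.1.trans (Real.rpow_le_rpow (Nat.cast_nonneg _) (Nat.cast_le.2 hn) hr0)
  have hnpos : 0 < n := pos_of_sampleThreshold_le hd hα hK hKpen hgap0 hρ hρ' hthr
  have hc3 : 0 < const3 d α K KY Kpen mstar := const3_pos hd hKY hKpen K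
  have hsummable := summable_exp_neg_mul_sigDim hd hc3
  refine ⟨hsummable, ?_⟩
  let A : ℕ → Set Ω := fun m => {ω |
    minEmpRisk α (fun i => Xs i ω) (fun i => Ys i ω) m + pen d Kpen ρ n m ≤
      minEmpRisk α (fun i => Xs i ω) (fun i => Ys i ω) mstar + pen d Kpen ρ n mstar}
  have hlarge : ∀ m, mstar < m → P.real (A m) ≤
      2 * Real.exp (-const3 d α K KY Kpen mstar * (sigDim d m : ℝ)) * E := by
    intro m hm
    obtain ⟨-, hsqrt⟩ := sqrt_sigDim_sub_sq hd hm
    have hD : 0 < pen d Kpen ρ n m - pen d Kpen ρ n mstar := by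
      have hc : 0 < Kpen * (n : ℝ) ^ (-ρ) :=
        mul_pos hKpen (Real.rpow_pos_of_pos (Nat.cast_pos.2 hnpos) _)
      unfold pen
      rw [← mul_sub]
      exact mul_pos hc hsqrt
    refine (measureReal_mono ?_).trans ((measureReal_exists_deviation_le hX hY hα hKY hYb hXb hnpos
      hindep hident m hD).trans ?_)
    · intro ω hω
      obtain ⟨β, hβ, hβe⟩ :=
        exists_empRisk_eq_minEmpRisk (fun i => Xs i ω) (fun i => Ys i ω) hα.le m
      -- At order m, β* loses empirically to β by at least the penalty increment, yet its true risk
      -- is no larger.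
      refine ⟨padSig hm.le βstar, β, by rwa [norm_padSig], hβ, ?_⟩
      rw [empRisk_padSig, risk_padSig, hβe]
      have h1 := risk_le_risk_of_condExp hX hY hβstar hYb hXb m β
      have h2 := minEmpRisk_le (fun i => Xs i ω) (fun i => Ys i ω) hβα
      simp only [A, Set.mem_ofPred_eq] at hω
      refine le_trans ?_ (le_abs_self _)
      linarith
    · rw [mul_assoc 2 (Real.exp _) E, hE, ← Real.exp_add]
      gcongr
      have := exponent_of_larger_order (gap := gap) hd hα hK hKY hKpen hρ' hnpos hm
      linarith
  have hsmall : ∀ m, m < mstar → P.real (A m) ≤ 2 * E := by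
    intro m hm
    have hm0 : mstar ≠ 0 := by omega
    have hgapY : gap ≤ KY ^ 2 := by
      have := minRisk_le_sq (X := X) hα.le hYb (mstar - 1)
      have := sq_nonneg σ
      linarith
    obtain ⟨hpen, hexp⟩ :=
      pen_le_half_gap_and_exponent hα hK hKY hKpen (hgap0 hm0) hgapY hnpos hm0 hthr
    have hpen0 : 0 ≤ pen d Kpen ρ n m := by unfold pen; positivity
    refine (measureReal_mono ?_).trans ((measureReal_exists_deviation_le hX hY hα hKY hYb hXb hnpos
      hindep hident mstar (half_pos (hgap0 hm0))).trans ?_)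
    · intro ω hω
      obtain ⟨β, hβ, hβe⟩ :=
        exists_empRisk_eq_minEmpRisk (fun i => Xs i ω) (fun i => Ys i ω) hα.le m
      -- At order m*, the true excess risk of β is at least the gap, its empirical excess at most
      -- half of it.
      refine ⟨padSig hm.le β, βstar, by rwa [norm_padSig], hβα, ?_⟩
      rw [empRisk_padSig, risk_padSig, hβe]
      have h1 := risk_le_of_condVar_le hX hY hβstar hYb hXb hσ
      have h2 := minEmpRisk_le (fun i => Xs i ω) (fun i => Ys i ω) hβα
      simp only [A, Set.mem_ofPred_eq] at hω
      have h4 : minRisk μ X Y α (mstar - 1) ≤ risk μ X Y m β := minRisk_le_risk (by omega) hβ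
      rw [abs_sub_comm]
      refine le_trans ?_ (le_abs_self _)
      linarith
    · rw [hE]
      gcongr
      linarith
  have hsub : {ω | mHat α Kpen ρ (fun i => Xs i ω) (fun i => Ys i ω) ≠ mstar} ⊆
      (⋃ j, A (mstar + 1 + j)) ∪ ⋃ m ∈ Finset.range mstar, A m := by
    intro ω hω
    obtain ⟨m, hm, hle⟩ := exists_le_of_mHat_ne _ _ hd hnpos hKpen hα.le hω
    rcases lt_or_gt_of_ne hm with hlt | hgt
    · exact Or.inr (Set.mem_biUnion (Finset.mem_coe.2 (Finset.mem_range.2 hlt)) hle)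
    · refine Or.inl (Set.mem_iUnion.2 ⟨m - (mstar + 1), ?_⟩)
      rwa [Nat.add_sub_cancel' hgt]
  have hE0 : 0 < E := Real.exp_pos _
  have htail : P.real (⋃ j, A (mstar + 1 + j)) ≤
      ∑' j : ℕ, 74 * E * Real.exp (-const3 d α K KY Kpen mstar * (sigDim d (j + 1) : ℝ)) := by
    refine measureReal_iUnion_le_tsum (hsummable.mul_left _) fun j => ?_
    refine (hlarge _ (by omega)).trans ?_
    -- The tail over m > m* is compared termwise with the series over m > 0 in C₁, as s_d is
    -- monotone.
    have hmono : Real.exp (-const3 d α K KY Kpen mstar * (sigDim d (mstar + 1 + j) : ℝ)) ≤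
        Real.exp (-const3 d α K KY Kpen mstar * (sigDim d (j + 1) : ℝ)) := by
      have : ((sigDim d (j + 1) : ℕ) : ℝ) ≤ sigDim d (mstar + 1 + j) := by
        exact_mod_cast sigDim_mono d (by omega)
      refine Real.exp_le_exp.2 ?_
      nlinarith
    nlinarith [mul_le_mul_of_nonneg_right hmono hE0.le, mul_pos (Real.exp_pos
      (-const3 d α K KY Kpen mstar * (sigDim d (j + 1) : ℝ))) hE0]
  have hhead : P.real (⋃ m ∈ Finset.range mstar, A m) ≤ mstar * (2 * E) := by
    refine (measureReal_biUnion_finset_le _ _).trans ?_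
    refine (Finset.sum_le_sum fun m hm => hsmall m (Finset.mem_range.1 hm)).trans ?_
    simp
  calc P.real {ω | mHat α Kpen ρ (fun i => Xs i ω) (fun i => Ys i ω) ≠ mstar}
      ≤ P.real (⋃ j, A (mstar + 1 + j)) + P.real (⋃ m ∈ Finset.range mstar, A m) :=
        (measureReal_mono hsub).trans (measureReal_union_le _ _)
    _ ≤ 74 * E * ∑' j : ℕ, Real.exp (-const3 d α K KY Kpen mstar * (sigDim d (j + 1) : ℝ)) +
        mstar * (2 * E) := by
        rw [← tsum_mul_left]
        exact add_le_add htail hhead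
    _ ≤ const1 d α K KY Kpen mstar * E := by
        have : (0 : ℝ) ≤ mstar * E := by positivity
        rw [const1]
        nlinarith
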